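/- **Theorem.** If ZF is consistent, then the standard first-order theory $\mathfrak{T}^\infty_0$ is consistent: $\left[\nvdash_{\mathrm{ZF}}\bot\right]\Rightarrow\left[\nvdash_{\mathfrak{T}^\infty_0}\bot\right]$, where $\vdash$ is derivability in classical first-order logic with equality, and ZF is Zermelo–Fraenkel set theory (extensionality, empty set, pairing, union, power set, infinity, regularity, and the separation and replacement schemata) in the language $\{\in\}$. The theory $\mathfrak{T}^\infty_0$ is a theory of sets and functions. Greek variables range over all things; every thing is a set or a function on a set. Roman variables $X, Y, Z, \dots$ (and $f$ in (20)) range over sets. For a set $X$, composite variables $f_X, h_X$ range over the functions on $X$ (a nonempty range). Besides variables there are the constants $\emptyset$, $\omega$, $1_\emptyset$ and the unary function symbol $(\cdot)^+$. The atomic formulas are $t_1=t_2$, $t_1\in t_2$, $t_1:t_2\twoheadrightarrow t_3$ ($t_1$ is a surjection from $t_2$ onto $t_3$) and $t_1:t_2\mapsto t_3$ ($t_1$ maps $t_2$ to $t_3$). The sorts are expressed in one-sorted first-order logic by a predicate "is a set" and a binary predicate "is a function on the set", to which the quantifiers over Roman and composite variables are relativized. The axioms are the following. Set-theoretical axioms: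 1. $\forall X\forall Y(X=Y\Leftrightarrow\forall\alpha(\alpha\in X\Leftrightarrow\alpha\in Y))$ 2. $\forall X\forall f_X\forall Y(f_X\neq Y)$ 3. $\forall X\forall\alpha\forall\beta(X:\alpha\not\twoheadrightarrow\beta\wedge X:\alpha\not\mapsto\beta)$ 4. $\exists X(X=\emptyset\wedge\forall\alpha(\alpha\notin X))$ 5. $\forall\alpha\forall\beta\exists X\forall\gamma(\gamma\in X\Leftrightarrow\gamma=\alpha\vee\gamma=\beta)$ 6. $\forall X\exists Y\forall\alpha(\alpha\in Y\Leftrightarrow\exists Z(Z\in X\wedge\alpha\in Z))$ 7. $\forall X\exists Y\forall\alpha(\alpha\in Y\Leftrightarrow\exists Z(Z\subseteq X\wedge\alpha=Z))$ 8. $\forall X\neq\emptyset\,\exists\alpha(\alpha\in X\wedge\forall\beta(\beta\in\alpha\Rightarrow\beta\notin X))$ 9. $\exists X(X=\omega\wedge\emptyset\in\omega\wedge\forall\alpha(\alpha\in\omega\Rightarrow\alpha^+\in\omega)\wedge\forall\beta\in\omega(\neg\exists\gamma\in\omega(\beta=\gamma^+)\Leftrightarrow\beta=\emptyset))$, where $(\cdot)^+$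 is governed by the axiom $\forall\alpha\forall\beta(\beta=\alpha^+\Leftrightarrow\exists X(\beta=X\wedge\forall\gamma(\gamma\in X\Leftrightarrow\gamma=\alpha)))$ Function-theoretical axioms: 10. $\forall X\forall f_X\forall\alpha(\alpha\notin f_X)$ 11. $\forall X\forall f_X(X\neq\emptyset\Rightarrow\exists Y\exists Z(f_X:Y\twoheadrightarrow Z\wedge\forall\alpha\in Y\,\exists!\beta(f_X:\alpha\mapsto\beta)))$ 12. $\forall X\forall f_X\forall\alpha(\alpha\neq X\Rightarrow\forall\xi(f_X:\alpha\not\twoheadrightarrow\xi))$ 13. $\forall X\forall f_X\forall\alpha\notin X\,\forall\beta(f_X:\alpha\not\mapsto\beta)$ 14. $\forall X\forall f_X(X\neq\emptyset\Rightarrow\forall\beta(f_X:X\twoheadrightarrow\beta\Rightarrow\exists Z(\beta=Z\wedge\forall\gamma(\gamma\in Z\Leftrightarrow\exists\eta\in X(f_X:\eta\mapsto\gamma)))))$ 15. $\forall X\neq\emptyset\,\forall f_X\forall Y(f_X:X\twoheadrightarrow Y\Rightarrow\forall\beta\exists Z\forall\alpha(\alpha\in Z\Leftrightarrow\alpha\in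 X\wedge f_X:\alpha\mapsto\beta))$ 16. $\exists f_\emptyset(f_\emptyset=1_\emptyset\wedge f_\emptyset:\emptyset\twoheadrightarrow\emptyset\wedge\forall\alpha\forall\beta(f_\emptyset:\alpha\not\mapsto\beta))$ 17. $\forall\alpha\forall\beta\exists f_{\alpha^+}(f_{\alpha^+}:\alpha^+\twoheadrightarrow\beta^+\wedge f_{\alpha^+}:\alpha\mapsto\beta)$ 18. $\forall X\forall f_X\forall Y(f_X:X\twoheadrightarrow Y\Rightarrow\forall\alpha(f_X:f_X\not\mapsto\alpha\wedge f_X:\alpha\not\mapsto f_X))$ Schemata, for all formulas $\Phi$, $\Psi$ of the language, with arbitrary parameters over which the instance is universally closed: 19. $\forall X\exists Y\forall\alpha(\alpha\in Y\Leftrightarrow\alpha\in X\wedge\Phi(\alpha))$ and $\forall X(\forall\alpha\in X\,\exists!\beta\,\Psi(\alpha,\beta)\Rightarrow\exists Z\forall\gamma(\gamma\in Z\Leftrightarrow\exists\xi(\xi\in X\wedge\Psi(\xi,\gamma))))$ Reverse graph theorem, taken as an axiom: 20. $\forall f\forall X\forall Y(f\in Y^X\Rightarrow\exists h_X\forall\alpha\forall\beta(h_X:\alpha\mapsto\beta\Leftrightarrow(\alpha,\beta)\in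 f))$ Here $(\alpha,\beta)=\{\alpha,\{\alpha,\beta\}\}$, and $f\in Y^X$ means that $f$ is the graph of a function from $X$ to $Y$: every element of $f$ is a two-tuple $(\alpha,\beta)$ with $\alpha\in X$ and $\beta\in Y$, and for every $\alpha\in X$ there is exactly one $\beta$ with $(\alpha,\beta)\in f$. -/

import Mathlib

namespace SetsAndFunctions

open FirstOrder FirstOrder.Language

/-! ## Classical first-order deduction

Formulas in context have free variables `x₀, x₁, x₂, …`, that is, they are elements of
`L.Formula ℕ`.  The rules are those of classical natural deduction with equality. -/

section Deduction

universe u v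

/-- `inst φ t` is `φ(t)`: the formula `φ` with the term `t` put for its only bound variable in
scope. -/
def inst {L : FirstOrder.Language.{u, v}} (φ : L.BoundedFormula ℕ 1) (t : L.Term ℕ) : L.Formula ℕ :=
  φ.toFormula.subst (Sum.elim Term.var (fun _ => t))

/-- Renames the free variables `x₀, x₁, …` to `x₁, x₂, …`, so that `x₀` becomes fresh. -/
def shift {L : FirstOrder.Language.{u, v}} (φ : L.Formula ℕ) : L.Formula ℕ :=
  φ.relabel Nat.succ

/-- The formula `φ(x₀)`, after the free variables of `φ` have been shifted to make `x₀` fresh. -/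
def instFresh {L : FirstOrder.Language.{u, v}} (φ : L.BoundedFormula ℕ 1) : L.Formula ℕ :=
  φ.toFormula.relabel (Sum.elim Nat.succ (fun _ => 0))

/-- `Derivable Γ φ`: the formula `φ` has a derivation from the hypotheses `Γ` in classical
first-order logic with equality.  (The primitive logical symbols are `⊥`, `=`, `→`, `∀`; the
other connectives abbreviate formulas built from these.) -/
inductive Derivable {L : FirstOrder.Language.{u, v}} : Set (L.Formula ℕ) → L.Formula ℕ → Prop
  | hyp {Γ : Set (L.Formula ℕ)} {φ : L.Formula ℕ} :
      φ ∈ Γ → Derivable Γ φ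
  | impIntro {Γ : Set (L.Formula ℕ)} {φ ψ : L.Formula ℕ} :
      Derivable (insert φ Γ) ψ → Derivable Γ (φ.imp ψ)
  | impElim {Γ : Set (L.Formula ℕ)} {φ ψ : L.Formula ℕ} :
      Derivable Γ (φ.imp ψ) → Derivable Γ φ → Derivable Γ ψ
  | byContra {Γ : Set (L.Formula ℕ)} {φ : L.Formula ℕ} :
      Derivable (insert (φ.imp ⊥) Γ) ⊥ → Derivable Γ φ
  | allIntro {Γ : Set (L.Formula ℕ)} {φ : L.BoundedFormula ℕ 1} :
      Derivable (shift '' Γ) (instFresh φ) → Derivable Γ φ.all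
  | allElim {Γ : Set (L.Formula ℕ)} {φ : L.BoundedFormula ℕ 1} (t : L.Term ℕ) :
      Derivable Γ φ.all → Derivable Γ (inst φ t)
  | eqRefl {Γ : Set (L.Formula ℕ)} (t : L.Term ℕ) :
      Derivable Γ (t.equal t)
  | eqSubst {Γ : Set (L.Formula ℕ)} {s t : L.Term ℕ} (φ : L.BoundedFormula ℕ 1) :
      Derivable Γ (s.equal t) → Derivable Γ (inst φ s) → Derivable Γ (inst φ t)

/-- `T ⊢ σ` for a theory `T` and a sentence `σ`. -/
def Proves {L : FirstOrder.Language.{u, v}} (T : L.Theory) (σ : L.Sentence) : Prop :=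
  Derivable ((fun τ : L.Sentence => Formula.relabel Empty.elim τ) '' T)
    (Formula.relabel Empty.elim σ)

/-- `T ⊬ ⊥`. -/
def Consistent {L : FirstOrder.Language.{u, v}} (T : L.Theory) : Prop :=
  ¬ Proves T ⊥

end Deduction

/-! ## Axiom schemata

In an instance of a schema the formula has parameters `p₀, …, p₍ₘ₋₁₎` (free variables indexed by
`Fin m`) and `j` distinguished variables; the instance is closed by universal quantification over
the parameters.  As everywhere below, `&k` is the variable bound by the quantifier at depth `k`,
counted from the outside and starting from `0`. -/

section Schemata

universe u v

/-- `φ(p, &(w 0), …, &(w (j-1)))`, the formula `φ` with parameters `p` at the given variables. -/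
def at' {L : FirstOrder.Language.{u, v}} {m j d : ℕ} (φ : L.Formula (Fin m ⊕ Fin j)) (w : Fin j → Fin d) :
    L.BoundedFormula (Fin m) d :=
  BoundedFormula.relabel (Sum.map id w) φ

/-- The universal closure `∀ p₀ ⋯ ∀ p₍ₘ₋₁₎ φ(p)`. -/
def closure {L : FirstOrder.Language.{u, v}} {m : ℕ} (φ : L.Formula (Fin m)) : L.Sentence :=
  BoundedFormula.alls (α := Empty) (n := m) (BoundedFormula.relabel Sum.inr φ)

end Schemata

/-! ## Zermelo–Fraenkel set theory -/

section ZF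

/-- The only nonlogical symbol of ZF: the binary relation symbol `∈`. -/
inductive ZFRel : ℕ → Type
  | mem : ZFRel 2

/-- The language of ZF. -/
def LZF : FirstOrder.Language.{0, 0} := ⟨fun _ => Empty, ZFRel⟩

/-- `a ∈ b` in the language of ZF. -/
def zmem {α : Type} {n : ℕ} (a b : LZF.Term (α ⊕ Fin n)) : LZF.BoundedFormula α n :=
  BoundedFormula.rel (L := LZF) ZFRel.mem ![a, b]

local infix:88 " ∈ᶻ " => zmem

/-- `∀ x ∀ y (∀ z (z ∈ x ↔ z ∈ y) → x = y)` -/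
def zfExtensionality : LZF.Sentence :=
  ∀' ∀' ((∀' (&2 ∈ᶻ &0 ⇔ &2 ∈ᶻ &1)) ⟹ &0 =' &1)

/-- `∃ x ∀ y, y ∉ x` -/
def zfEmpty : LZF.Sentence :=
  ∃' ∀' ∼(&1 ∈ᶻ &0)

/-- `∀ x ∀ y ∃ z ∀ w (w ∈ z ↔ w = x ∨ w = y)` -/
def zfPairing : LZF.Sentence :=
  ∀' ∀' ∃' ∀' (&3 ∈ᶻ &2 ⇔ (&3 =' &0 ⊔ &3 =' &1))

/-- `∀ x ∃ y ∀ z (z ∈ y ↔ ∃ w (w ∈ x ∧ z ∈ w))` -/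
def zfUnion : LZF.Sentence :=
  ∀' ∃' ∀' (&2 ∈ᶻ &1 ⇔ ∃' (&3 ∈ᶻ &0 ⊓ &2 ∈ᶻ &3))

/-- `∀ x ∃ y ∀ z (z ∈ y ↔ ∀ w (w ∈ z → w ∈ x))` -/
def zfPower : LZF.Sentence :=
  ∀' ∃' ∀' (&2 ∈ᶻ &1 ⇔ ∀' (&3 ∈ᶻ &2 ⟹ &3 ∈ᶻ &0))

/-- `∃ x (∃ e (∀ y y ∉ e ∧ e ∈ x) ∧ ∀ y (y ∈ x → ∃ z (z ∈ x ∧ ∀ w (w ∈ z ↔ w ∈ y ∨ w = y))))` -/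
def zfInfinity : LZF.Sentence :=
  ∃' ((∃' ((∀' ∼(&2 ∈ᶻ &1)) ⊓ &1 ∈ᶻ &0)) ⊓
    ∀' (&1 ∈ᶻ &0 ⟹ ∃' (&2 ∈ᶻ &0 ⊓ ∀' (&3 ∈ᶻ &2 ⇔ (&3 ∈ᶻ &1 ⊔ &3 =' &1)))))

/-- `∀ x (∃ y (y ∈ x) → ∃ y (y ∈ x ∧ ∀ z (z ∈ y → z ∉ x)))` -/
def zfRegularity : LZF.Sentence :=
  ∀' ((∃' (&1 ∈ᶻ &0)) ⟹ ∃' (&1 ∈ᶻ &0 ⊓ ∀' (&2 ∈ᶻ &1 ⟹ ∼(&2 ∈ᶻ &0))))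

/-- `∀ p ∀ x ∃ y ∀ z (z ∈ y ↔ z ∈ x ∧ φ(p, z))` -/
def zfSeparation {m : ℕ} (φ : LZF.Formula (Fin m ⊕ Fin 1)) : LZF.Sentence :=
  closure (∀' ∃' ∀' (&2 ∈ᶻ &1 ⇔ (&2 ∈ᶻ &0 ⊓ at' φ ![2])))

/-- `∀ p ∀ x (∀ y (y ∈ x → ∃! z ψ(p, y, z)) → ∃ z ∀ w (w ∈ z ↔ ∃ y (y ∈ x ∧ ψ(p, y, w))))` -/
def zfReplacement {m : ℕ} (ψ : LZF.Formula (Fin m ⊕ Fin 2)) : LZF.Sentence :=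
  closure (∀' ((∀' (&1 ∈ᶻ &0 ⟹ ∃' (at' ψ ![1, 2] ⊓ ∀' (at' ψ ![1, 3] ⟹ &3 =' &2)))) ⟹
    ∃' ∀' (&2 ∈ᶻ &1 ⇔ ∃' (&3 ∈ᶻ &0 ⊓ at' ψ ![3, 2]))))

/-- Zermelo–Fraenkel set theory (without the axiom of choice). -/
def ZF : LZF.Theory :=
  {zfExtensionality, zfEmpty, zfPairing, zfUnion, zfPower, zfInfinity, zfRegularity} ∪
  {σ | ∃ (m : ℕ) (φ : LZF.Formula (Fin m ⊕ Fin 1)), σ = zfSeparation φ} ∪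
  {σ | ∃ (m : ℕ) (ψ : LZF.Formula (Fin m ⊕ Fin 2)), σ = zfReplacement ψ}

end ZF

/-! ## The theory of sets and functions

The theory has variables of several sorts: Greek variables range over all things, Roman variables
over sets and, for a set `X`, composite variables `f_X` over the functions on `X`.  As usual, sorts
are expressed by relation symbols: `isSet x` says that `x` is a set, `isFun f X` that `f` is a
function on the set `X`, and quantifiers over Roman and composite variables are relativized to
these. -/

section SetFun

/-- The function symbols: the constants `∅`, `ω`, `1_∅` and the unary symbol `(·)⁺`. -/
inductive TFunc : ℕ → Type
  | empty : TFunc 0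
  | omega : TFunc 0
  | inactive : TFunc 0
  | plus : TFunc 1

/-- The relation symbols: the sorts, membership `a ∈ b`, `f : a ↠ b`, and `f : a ↦ b`. -/
inductive TRel : ℕ → Type
  | isSet : TRel 1
  | isFun : TRel 2
  | mem : TRel 2
  | onto : TRel 3
  | maps : TRel 3

/-- The language of the theory of sets and functions. -/
def LT : FirstOrder.Language.{0, 0} := ⟨TFunc, TRel⟩

variable {α : Type} {n : ℕ}

/-- The constant `∅`. -/
def emp : LT.Term (α ⊕ Fin n) := Term.func (L := LT) TFunc.empty ![]

/-- The constant `ω`. -/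
def omg : LT.Term (α ⊕ Fin n) := Term.func (L := LT) TFunc.omega ![]

/-- The constant `1_∅`. -/
def one : LT.Term (α ⊕ Fin n) := Term.func (L := LT) TFunc.inactive ![]

/-- The term `t⁺`. -/
def plus (t : LT.Term (α ⊕ Fin n)) : LT.Term (α ⊕ Fin n) := Term.func (L := LT) TFunc.plus ![t]

/-- `t` is a set. -/
def isSet (t : LT.Term (α ⊕ Fin n)) : LT.BoundedFormula α n :=
  BoundedFormula.rel (L := LT) TRel.isSet ![t]

/-- `f` is a function on the set `X`. -/
def isFun (f X : LT.Term (α ⊕ Fin n)) : LT.BoundedFormula α n :=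
  BoundedFormula.rel (L := LT) TRel.isFun ![f, X]

/-- `a ∈ b` -/
def tmem (a b : LT.Term (α ⊕ Fin n)) : LT.BoundedFormula α n :=
  BoundedFormula.rel (L := LT) TRel.mem ![a, b]

/-- `f : a ↠ b` -/
def onto (f a b : LT.Term (α ⊕ Fin n)) : LT.BoundedFormula α n :=
  BoundedFormula.rel (L := LT) TRel.onto ![f, a, b]

/-- `f : a ↦ b` -/
def maps (f a b : LT.Term (α ⊕ Fin n)) : LT.BoundedFormula α n :=
  BoundedFormula.rel (L := LT) TRel.maps ![f, a, b]

local infix:88 " ∈ᵗ " => tmem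

/-- The term `t`, read under one more quantifier. -/
def up (t : LT.Term (α ⊕ Fin n)) : LT.Term (α ⊕ Fin (n + 1)) :=
  t.relabel (Sum.map id Fin.castSucc)

/-- The variable bound by the innermost quantifier. -/
def new : LT.Term (α ⊕ Fin (n + 1)) := Term.var (Sum.inr (Fin.last n))

/-- `∀ X φ` for a Roman variable `X`. -/
def allSet (φ : LT.BoundedFormula α (n + 1)) : LT.BoundedFormula α n :=
  ∀' (isSet new ⟹ φ)

/-- `∃ X φ` for a Roman variable `X`. -/
def exSet (φ : LT.BoundedFormula α (n + 1)) : LT.BoundedFormula α n :=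
  ∃' (isSet new ⊓ φ)

/-- `∀ f_X φ` for a composite variable `f_X`. -/
def allFun (X : LT.Term (α ⊕ Fin n)) (φ : LT.BoundedFormula α (n + 1)) :
    LT.BoundedFormula α n :=
  ∀' (isFun new (up X) ⟹ φ)

/-- `∃ f_X φ` for a composite variable `f_X`. -/
def exFun (X : LT.Term (α ⊕ Fin n)) (φ : LT.BoundedFormula α (n + 1)) :
    LT.BoundedFormula α n :=
  ∃' (isFun new (up X) ⊓ φ)

/-- `∀ ξ ∈ X φ` for a Greek variable `ξ`. -/
def allIn (X : LT.Term (α ⊕ Fin n)) (φ : LT.BoundedFormula α (n + 1)) :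
    LT.BoundedFormula α n :=
  ∀' (new ∈ᵗ up X ⟹ φ)

/-- `∃ ξ ∈ X φ` for a Greek variable `ξ`. -/
def exIn (X : LT.Term (α ⊕ Fin n)) (φ : LT.BoundedFormula α (n + 1)) :
    LT.BoundedFormula α n :=
  ∃' (new ∈ᵗ up X ⊓ φ)

/-! ### Conventions on the sorts -/

/-- Every thing is a set or a function on a set. -/
def sortThing : LT.Sentence :=
  ∀' (isSet &0 ⊔ exSet (isFun &0 &1))

/-- Composite variables have a set as subscript. -/
def sortFun : LT.Sentence :=
  ∀' ∀' (isFun &0 &1 ⟹ isSet &1)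

/-- The range of a composite variable is nonempty. -/
def sortNonempty : LT.Sentence :=
  allSet (exFun &0 (&1 =' &1))

/-! ### Set-theoretical axioms -/

/-- `∀ X ∀ Y (X = Y ⇔ ∀ α (α ∈ X ⇔ α ∈ Y))` -/
def axExt : LT.Sentence :=
  allSet (allSet (&0 =' &1 ⇔ ∀' (&2 ∈ᵗ &0 ⇔ &2 ∈ᵗ &1)))

/-- `∀ X ∀ f_X ∀ Y (f_X ≠ Y)` -/
def axFunNotSet : LT.Sentence :=
  allSet (allFun &0 (allSet ∼(&1 =' &2)))

/-- `∀ X ∀ α ∀ β (¬ X : α ↠ β ∧ ¬ X : α ↦ β)` -/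
def axSetNotFun : LT.Sentence :=
  allSet (∀' ∀' (∼(onto &0 &1 &2) ⊓ ∼(maps &0 &1 &2)))

/-- `∃ X (X = ∅ ∧ ∀ α (α ∉ X))` -/
def axEmpty : LT.Sentence :=
  exSet (&0 =' emp ⊓ ∀' ∼(&1 ∈ᵗ &0))

/-- `∀ α ∀ β ∃ X ∀ γ (γ ∈ X ⇔ γ = α ∨ γ = β)` -/
def axPair : LT.Sentence :=
  ∀' ∀' (exSet (∀' (&3 ∈ᵗ &2 ⇔ (&3 =' &0 ⊔ &3 =' &1))))

/-- `∀ X ∃ Y ∀ α (α ∈ Y ⇔ ∃ Z (Z ∈ X ∧ α ∈ Z))` -/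
def axUnion : LT.Sentence :=
  allSet (exSet (∀' (&2 ∈ᵗ &1 ⇔ exSet (&3 ∈ᵗ &0 ⊓ &2 ∈ᵗ &3))))

/-- `∀ X ∃ Y ∀ α (α ∈ Y ⇔ ∃ Z (Z ⊆ X ∧ α = Z))` -/
def axPower : LT.Sentence :=
  allSet (exSet (∀' (&2 ∈ᵗ &1 ⇔ exSet ((∀' (&4 ∈ᵗ &3 ⟹ &4 ∈ᵗ &0)) ⊓ &2 =' &3))))

/-- `∀ X ≠ ∅ ∃ α (α ∈ X ∧ ∀ β (β ∈ α ⇒ β ∉ X))` -/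
def axRegularity : LT.Sentence :=
  allSet (∼(&0 =' emp) ⟹ ∃' (&1 ∈ᵗ &0 ⊓ ∀' (&2 ∈ᵗ &1 ⟹ ∼(&2 ∈ᵗ &0))))

/-- `∃ X (X = ω ∧ ∅ ∈ ω ∧ ∀ α (α ∈ ω ⇒ α⁺ ∈ ω) ∧ ∀ β ∈ ω (¬ ∃ γ ∈ ω (β = γ⁺) ⇔ β = ∅))` -/
def axInfinity : LT.Sentence :=
  exSet (&0 =' omg ⊓ emp ∈ᵗ omg ⊓ (∀' (&1 ∈ᵗ omg ⟹ plus &1 ∈ᵗ omg)) ⊓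
    allIn omg (∼(exIn omg (&1 =' plus &2)) ⇔ &1 =' emp))

/-- `∀ α ∀ β (β = α⁺ ⇔ ∃ X (β = X ∧ ∀ γ (γ ∈ X ⇔ γ = α)))` -/
def axPlus : LT.Sentence :=
  ∀' ∀' (&1 =' plus &0 ⇔ exSet (&1 =' &2 ⊓ ∀' (&3 ∈ᵗ &2 ⇔ &3 =' &0)))

/-! ### Function-theoretical axioms -/

/-- `∀ X ∀ f_X ∀ α (α ∉ f_X)` -/
def axFunNoElem : LT.Sentence :=
  allSet (allFun &0 (∀' ∼(&2 ∈ᵗ &1)))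

/-- `∀ X ∀ f_X (X ≠ ∅ ⇒ ∃ Y ∃ Z (f_X : Y ↠ Z ∧ ∀ α ∈ Y ∃! β (f_X : α ↦ β)))` -/
def axFunTotal : LT.Sentence :=
  allSet (allFun &0 (∼(&0 =' emp) ⟹ exSet (exSet (onto &1 &2 &3 ⊓
    allIn &2 (∃' (maps &1 &4 &5 ⊓ ∀' (maps &1 &4 &6 ⟹ &6 =' &5)))))))

/-- `∀ X ∀ f_X ∀ α (α ≠ X ⇒ ∀ ξ (¬ f_X : α ↠ ξ))` -/
def axFunDomain : LT.Sentence :=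
  allSet (allFun &0 (∀' (∼(&2 =' &0) ⟹ ∀' ∼(onto &1 &2 &3))))

/-- `∀ X ∀ f_X ∀ α ∉ X ∀ β (¬ f_X : α ↦ β)` -/
def axFunOutside : LT.Sentence :=
  allSet (allFun &0 (∀' (∼(&2 ∈ᵗ &0) ⟹ ∀' ∼(maps &1 &2 &3))))

/-- `∀ X ∀ f_X (X ≠ ∅ ⇒ ∀ β (f_X : X ↠ β ⇒`
`∃ Z (β = Z ∧ ∀ γ (γ ∈ Z ⇔ ∃ η ∈ X (f_X : η ↦ γ)))))` -/
def axFunRange : LT.Sentence :=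
  allSet (allFun &0 (∼(&0 =' emp) ⟹ ∀' (onto &1 &0 &2 ⟹
    exSet (&2 =' &3 ⊓ ∀' (&4 ∈ᵗ &3 ⇔ exIn &0 (maps &1 &5 &4))))))

/-- `∀ X ≠ ∅ ∀ f_X ∀ Y (f_X : X ↠ Y ⇒ ∀ β ∃ Z ∀ α (α ∈ Z ⇔ α ∈ X ∧ f_X : α ↦ β))` -/
def axFunPreimage : LT.Sentence :=
  allSet (∼(&0 =' emp) ⟹ allFun &0 (allSet (onto &1 &0 &2 ⟹
    ∀' (exSet (∀' (&5 ∈ᵗ &4 ⇔ (&5 ∈ᵗ &0 ⊓ maps &1 &5 &3)))))))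

/-- `∃ f_∅ (f_∅ = 1_∅ ∧ f_∅ : ∅ ↠ ∅ ∧ ∀ α ∀ β (¬ f_∅ : α ↦ β))` -/
def axInactive : LT.Sentence :=
  exFun emp (&0 =' one ⊓ onto &0 emp emp ⊓ ∀' ∀' ∼(maps &0 &1 &2))

/-- `∀ α ∀ β ∃ f_{α⁺} (f_{α⁺} : α⁺ ↠ β⁺ ∧ f_{α⁺} : α ↦ β)` -/
def axUrFunction : LT.Sentence :=
  ∀' ∀' (exFun (plus &0) (onto &2 (plus &0) (plus &1) ⊓ maps &2 &0 &1))

/-- `∀ X ∀ f_X ∀ Y (f_X : X ↠ Y ⇒ ∀ α (¬ f_X : f_X ↦ α ∧ ¬ f_X : α ↦ f_X))` -/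
def axFunRegularity : LT.Sentence :=
  allSet (allFun &0 (allSet (onto &1 &0 &2 ⟹
    ∀' (∼(maps &1 &1 &3) ⊓ ∼(maps &1 &3 &1)))))

/-! ### Separation, replacement, and the reverse graph theorem -/

/-- `∀ p ∀ X ∃ Y ∀ α (α ∈ Y ⇔ α ∈ X ∧ φ(p, α))` -/
def separation {m : ℕ} (φ : LT.Formula (Fin m ⊕ Fin 1)) : LT.Sentence :=
  closure (allSet (exSet (∀' (&2 ∈ᵗ &1 ⇔ (&2 ∈ᵗ &0 ⊓ at' φ ![2])))))

/-- `∀ p ∀ X (∀ α ∈ X ∃! β ψ(p, α, β) ⇒ ∃ Z ∀ γ (γ ∈ Z ⇔ ∃ ξ (ξ ∈ X ∧ ψ(p, ξ, γ))))` -/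
def replacement {m : ℕ} (ψ : LT.Formula (Fin m ⊕ Fin 2)) : LT.Sentence :=
  closure (allSet (allIn &0 (∃' (at' ψ ![1, 2] ⊓ ∀' (at' ψ ![1, 3] ⟹ &3 =' &2))) ⟹
    exSet (∀' (&2 ∈ᵗ &1 ⇔ ∃' (&3 ∈ᵗ &0 ⊓ at' ψ ![3, 2])))))

/-- `p` is the set `{a, b}`. -/
def isPair (p a b : LT.Term (α ⊕ Fin n)) : LT.BoundedFormula α n :=
  isSet p ⊓ ∀' (new ∈ᵗ up p ⇔ (new =' up a ⊔ new =' up b))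

/-- `p` is the two-tuple `(a, b) = {a, {a, b}}`. -/
def isTuple (p a b : LT.Term (α ⊕ Fin n)) : LT.BoundedFormula α n :=
  ∃' (isPair new (up a) (up b) ⊓ isPair (up p) (up a) new)

/-- `(a, b) ∈ f` -/
def tupleMem (a b f : LT.Term (α ⊕ Fin n)) : LT.BoundedFormula α n :=
  ∃' (isTuple new (up a) (up b) ⊓ new ∈ᵗ up f)

/-- `f ∈ Y^X`, that is, `f` is the graph of a function from `X` to `Y`: each element of `f` is a
two-tuple `(α, β)` with `α ∈ X` and `β ∈ Y`, and for each `α ∈ X` there is exactly one `β` with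
`(α, β) ∈ f`. -/
def isGraph (f X Y : LT.Term (α ⊕ Fin n)) : LT.BoundedFormula α n :=
  allIn f (exIn (up X) (exIn (up (up Y)) (isTuple (up (up new)) (up new) new))) ⊓
  allIn X (∃' (tupleMem (up new) new (up (up f)) ⊓
    ∀' (tupleMem (up (up new)) new (up (up (up f))) ⟹ new =' up new)))

/-- `∀ f ∀ X ∀ Y (f ∈ Y^X ⇒ ∃ h_X ∀ α ∀ β (h_X : α ↦ β ⇔ (α, β) ∈ f))` -/
def reverseGraph : LT.Sentence :=
  allSet (allSet (allSet (isGraph &0 &1 &2 ⟹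
    exFun &1 (∀' ∀' (maps &3 &4 &5 ⇔ tupleMem &4 &5 &0)))))

/-- The theory `𝔗^∞_0`: the standard axioms of the theory of sets and functions, the separation
and replacement schemata, and the reverse graph theorem. -/
def TInfty0 : LT.Theory :=
  {sortThing, sortFun, sortNonempty} ∪
  {axExt, axFunNotSet, axSetNotFun, axEmpty, axPair, axUnion, axPower, axRegularity, axInfinity,
    axPlus} ∪
  {axFunNoElem, axFunTotal, axFunDomain, axFunOutside, axFunRange, axFunPreimage, axInactive,
    axUrFunction, axFunRegularity} ∪
  {σ | ∃ (m : ℕ) (φ : LT.Formula (Fin m ⊕ Fin 1)), σ = separation φ} ∪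
  {σ | ∃ (m : ℕ) (ψ : LT.Formula (Fin m ⊕ Fin 2)), σ = replacement ψ} ∪
  {reverseGraph}

end SetFun

end SetsAndFunctions

/-! The proof builds a model of the theory of sets and functions inside a model of ZF. By
completeness (`exists_model_of_consistent`), consistency of ZF gives a model `M`; soundness
(`consistent_of_model`) turns the model built from it into consistency of the target theory.

The new model keeps every element of `M` except its empty set `o`, which becomes a marker. A thing
is a set if it contains `o`, and its elements are then its members other than `o`; a thing without
`o` is a non-set and has no elements. Thus the empty set is {o} and the singleton of x is {x, o}.
Adjoining `o` turns any collection of things that is a set of `M` into a set (`Thing.exists_set`),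
so the set-theoretic axioms descend from `M`. For ω one needs the orbit of {o} under x ↦ {x, o},
obtained in `ZFModel.exists_orbit` by recursion along the infinite set of `M`.

Every non-set is a function. The non-set {F} codes the set F: if F is functional, it maps a to b
exactly when (a, b) ∈ F. All other non-sets map nothing and are functions on the empty set. No
extensionality is asked of functions, so this is harmless. Every functional set thus is the graph of
a function, which gives the reverse graph theorem, and regularity of `M` keeps {F} out of the tuples
in F.

The schemata range over all formulas of the new language. By `dfn_realize`, each such formula
defines a predicate whose pullback to `M` is definable there with parameters, so separation and
replacement in `M` apply. `CodedUniverse` collects what the function axioms need from this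
construction, and `CodedUniverse.exists_tModel` derives the axioms from it. -/

namespace SetsAndFunctions

open FirstOrder FirstOrder.Language

/-! ## Renaming of variables -/

section Renaming

universe u v
variable {L : FirstOrder.Language.{u, v}} {α β γ : Type}

/-- Extends a renaming of variables below one more quantifier. -/
def liftRen {n m : ℕ} (ρ : α ⊕ Fin n → β ⊕ Fin m) : α ⊕ Fin (n + 1) → β ⊕ Fin (m + 1) :=
  Sum.elim (fun a => Sum.map id Fin.castSucc (ρ (Sum.inl a)))
    (Fin.lastCases (Sum.inr (Fin.last m)) fun j => Sum.map id Fin.castSucc (ρ (Sum.inr j)))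

@[simp] theorem liftRen_inl {n m : ℕ} (ρ : α ⊕ Fin n → β ⊕ Fin m) (a : α) :
    liftRen ρ (Sum.inl a) = Sum.map id Fin.castSucc (ρ (Sum.inl a)) := rfl

@[simp] theorem liftRen_last {n m : ℕ} (ρ : α ⊕ Fin n → β ⊕ Fin m) :
    liftRen ρ (Sum.inr (Fin.last n)) = Sum.inr (Fin.last m) := by
  simp [liftRen]

@[simp] theorem liftRen_castSucc {n m : ℕ} (ρ : α ⊕ Fin n → β ⊕ Fin m) (j : Fin n) :
    liftRen ρ (Sum.inr j.castSucc) = Sum.map id Fin.castSucc (ρ (Sum.inr j)) := by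
  simp [liftRen]

theorem liftRen_comp {n m k : ℕ} (τ : β ⊕ Fin m → γ ⊕ Fin k) (ρ : α ⊕ Fin n → β ⊕ Fin m) :
    liftRen (τ ∘ ρ) = liftRen τ ∘ liftRen ρ := by
  have h : ∀ y : β ⊕ Fin m, liftRen τ (Sum.map id Fin.castSucc y)
      = Sum.map id Fin.castSucc (τ y) := by
    rintro (y | y) <;> simp
  funext x
  rcases x with a | i
  · simp [h]
  · refine Fin.lastCases ?_ (fun j => ?_) i <;> simp [h]

/-- Renames the free and bound-in-scope variables of a formula. -/
def rename : ∀ {n : ℕ}, L.BoundedFormula α n → ∀ {m : ℕ}, (α ⊕ Fin n → β ⊕ Fin m) →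
    L.BoundedFormula β m
  | _, .falsum, _, _ => .falsum
  | _, .equal s t, _, ρ => .equal (s.relabel ρ) (t.relabel ρ)
  | _, .rel R ts, _, ρ => .rel R fun i => (ts i).relabel ρ
  | _, .imp φ ψ, _, ρ => .imp (rename φ ρ) (rename ψ ρ)
  | _, .all φ, _, ρ => .all (rename φ (liftRen ρ))

/-- Relabelling, instantiation at a variable, `shift` and `toFormula` are all expressed below by
`rename`. With this composition law, an identity between two of their composites is checked on
variables alone. -/
theorem rename_rename {n m k : ℕ} (φ : L.BoundedFormula α n) (ρ : α ⊕ Fin n → β ⊕ Fin m)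
    (τ : β ⊕ Fin m → γ ⊕ Fin k) : rename (rename φ ρ) τ = rename φ (τ ∘ ρ) := by
  induction φ generalizing m k with
  | falsum => rfl
  | equal s t => simp [rename]
  | rel R ts => simp [rename]
  | imp φ ψ h₁ h₂ => simp [rename, h₁, h₂]
  | all φ h => simp [rename, h, liftRen_comp]

theorem liftRen_relabelAux {n k : ℕ} (g : α → β ⊕ Fin n) :
    liftRen (BoundedFormula.relabelAux g k) = BoundedFormula.relabelAux g (k + 1) := by
  funext x
  rcases x with a | i
  · rcases h : g a with b | j
    · simp [BoundedFormula.relabelAux, h]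
    · simp [BoundedFormula.relabelAux, h]; rfl
  · refine Fin.lastCases ?_ (fun j => ?_) i <;> simp [BoundedFormula.relabelAux]

theorem relabel_eq_rename {n k : ℕ} (g : α → β ⊕ Fin n) (φ : L.BoundedFormula α k) :
    φ.relabel g = rename φ (BoundedFormula.relabelAux g k) := by
  induction φ with
  | falsum => rfl
  | equal s t => rfl
  | rel R ts => rfl
  | imp φ ψ h₁ h₂ => simp [rename, h₁, h₂]
  | all φ h =>
    rw [BoundedFormula.relabel_all, h, ← liftRen_relabelAux]; rfl

theorem formula_relabel_eq_rename (f : α → β) (φ : L.Formula α) :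
    φ.relabel f = rename φ (Sum.map f id) := by
  refine (relabel_eq_rename _ _).trans (congrArg _ ?_)
  funext x
  rcases x with a | i
  · rfl
  · exact i.elim0

theorem toFormula_eq_rename {n : ℕ} (φ : L.BoundedFormula α n) :
    φ.toFormula = rename φ (Sum.inl : α ⊕ Fin n → (α ⊕ Fin n) ⊕ Fin 0) := by
  induction φ with
  | falsum => rfl
  | equal s t => rfl
  | rel R ts => rfl
  | imp φ ψ h₁ h₂ => simp only [BoundedFormula.toFormula, rename, h₁, h₂]
  | @all n φ h =>
    simp only [BoundedFormula.toFormula, rename, h]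
    refine congrArg BoundedFormula.all ?_
    refine (relabel_eq_rename _ _).trans ((rename_rename _ _ _).trans (congrArg _ ?_))
    funext x
    rcases x with a | i
    · rfl
    · refine Fin.lastCases ?_ (fun j => ?_) i
      · simp [BoundedFormula.relabelAux]; rfl
      · simp [BoundedFormula.relabelAux]

@[simp] theorem liftRen_map {n : ℕ} (f : α → β) :
    liftRen (Sum.map f id : α ⊕ Fin n → β ⊕ Fin n) = Sum.map f id := by
  funext x
  rcases x with a | i
  · rfl
  · refine Fin.lastCases ?_ (fun j => ?_) i <;> simp

/-- Substituting variables for variables is the only substitution that matters in a relational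
language, where every term is a variable. -/
theorem subst_var_eq_rename {n : ℕ} (φ : L.BoundedFormula α n) (f : α → β) :
    φ.subst (fun a => Term.var (f a)) = rename φ (Sum.map f id) := by
  have ht : ∀ {n : ℕ} (t : L.Term (α ⊕ Fin n)),
      t.subst (Sum.elim (Term.relabel Sum.inl ∘ fun a => Term.var (f a)) (Term.var ∘ Sum.inr))
        = t.relabel (Sum.map f id) := by
    intro n t
    induction t with
    | var x => rcases x with a | i <;> rfl
    | func F ts h => simp [Term.subst, h]
  induction φ with
  | falsum => rfl
  | equal s t => simp [BoundedFormula.subst, BoundedFormula.mapTermRel, rename, ht]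
  | rel R ts => simp [BoundedFormula.subst, BoundedFormula.mapTermRel, rename, ht]
  | imp φ ψ h₁ h₂ => simp only [rename, ← h₁, ← h₂]; rfl
  | @all n φ h =>
    simp only [rename, liftRen_map, ← h]; rfl

theorem inst_var_eq_rename (φ : L.BoundedFormula ℕ 1) (k : ℕ) :
    inst φ (Term.var k) = rename φ (Sum.elim Sum.inl fun _ => Sum.inl k) := by
  have : (Sum.elim Term.var fun _ => Term.var k : ℕ ⊕ Fin 1 → L.Term ℕ)
      = fun a => Term.var (Sum.elim id (fun _ => k) a) := by
    funext x; rcases x with a | i <;> rfl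
  rw [inst, this, subst_var_eq_rename, toFormula_eq_rename, rename_rename]
  congr 1
  funext x; rcases x with a | i <;> rfl

theorem instFresh_eq_rename (φ : L.BoundedFormula ℕ 1) :
    instFresh φ = rename φ (Sum.elim (fun a => Sum.inl (a + 1)) fun _ => Sum.inl 0) := by
  rw [instFresh, formula_relabel_eq_rename, toFormula_eq_rename, rename_rename]
  congr 1
  funext x; rcases x with a | i <;> rfl

theorem rename_equal (s t : L.Term α) (f : α → β) :
    rename (s.equal t) (Sum.map f id : α ⊕ Fin 0 → β ⊕ Fin 0)
      = (s.relabel f).equal (t.relabel f) := by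
  simp only [Term.equal, Term.bdEqual, rename, Term.relabel_relabel]
  rfl

theorem rename_inst (φ : L.BoundedFormula ℕ 1) (k : ℕ) (f : ℕ → ℕ) :
    rename (inst φ (Term.var k)) (Sum.map f id)
      = inst (rename φ (Sum.map f id)) (Term.var (f k)) := by
  rw [inst_var_eq_rename, inst_var_eq_rename, rename_rename, rename_rename]
  congr 1
  funext x; rcases x with a | i <;> rfl

/-- The renaming that fixes `x₀` and acts as `f` on `x₁, x₂, …`. -/
def underFresh (f : ℕ → ℕ) : ℕ → ℕ := fun k => Nat.casesOn k 0 fun k => f k + 1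

/-- Together with `rename_shift`, this carries the premise of ∀-introduction through a renaming:
`underFresh` leaves the eigenvariable x₀ alone. -/
theorem rename_instFresh (φ : L.BoundedFormula ℕ 1) (f : ℕ → ℕ) :
    rename (instFresh φ) (Sum.map (underFresh f) id)
      = instFresh (rename φ (Sum.map f id)) := by
  rw [instFresh_eq_rename, instFresh_eq_rename, rename_rename, rename_rename]
  congr 1
  funext x; rcases x with a | i <;> rfl

theorem rename_shift (φ : L.Formula ℕ) (f : ℕ → ℕ) :
    rename (shift φ) (Sum.map (underFresh f) id) = shift (rename φ (Sum.map f id)) := by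
  rw [shift, shift, formula_relabel_eq_rename, formula_relabel_eq_rename, rename_rename,
    rename_rename]
  congr 1
  funext x; rcases x with a | i <;> rfl

/-- The free variables of `φ` are among `x₀, …, x₍ₖ₋₁₎`. -/
def SupportedBelow {n : ℕ} (φ : L.BoundedFormula ℕ n) (K : ℕ) : Prop :=
  -- The condition is stated through its effect: a renaming is determined on `φ` by its values on
  -- the first `K` free variables and on those bound in scope.
  ∀ ⦃m : ℕ⦄ (ρ τ : ℕ ⊕ Fin n → ℕ ⊕ Fin m), (∀ a < K, ρ (Sum.inl a) = τ (Sum.inl a)) →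
    (∀ i, ρ (Sum.inr i) = τ (Sum.inr i)) → rename φ ρ = rename φ τ

theorem SupportedBelow.mono {n : ℕ} {φ : L.BoundedFormula ℕ n} {K K' : ℕ}
    (h : SupportedBelow φ K) (hK : K ≤ K') : SupportedBelow φ K' :=
  fun _ ρ τ h₁ h₂ => h ρ τ (fun a ha => h₁ a (ha.trans_le hK)) h₂

theorem exists_relabel_eq_of_lt {n : ℕ} (t : L.Term (ℕ ⊕ Fin n)) : ∃ K, ∀ ⦃m : ℕ⦄
    (ρ τ : ℕ ⊕ Fin n → ℕ ⊕ Fin m), (∀ a < K, ρ (Sum.inl a) = τ (Sum.inl a)) →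
    (∀ i, ρ (Sum.inr i) = τ (Sum.inr i)) → t.relabel ρ = t.relabel τ := by
  induction t with
  | var x =>
    rcases x with a | i
    · exact ⟨a + 1, fun m ρ τ h _ => congrArg Term.var (h a a.lt_succ_self)⟩
    · exact ⟨0, fun m ρ τ _ h => congrArg Term.var (h i)⟩
  | func F ts h =>
    choose K hK using h
    refine ⟨Finset.univ.sup K, fun m ρ τ h₁ h₂ => ?_⟩
    simp only [Term.relabel]
    congr 1
    funext i
    exact hK i ρ τ (fun a ha => h₁ a (ha.trans_le (Finset.le_sup (Finset.mem_univ i)))) h₂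

theorem exists_supportedBelow {n : ℕ} (φ : L.BoundedFormula ℕ n) : ∃ K, SupportedBelow φ K := by
  induction φ with
  | falsum => exact ⟨0, fun _ _ _ _ _ => rfl⟩
  | equal s t =>
    obtain ⟨K₁, h₁⟩ := exists_relabel_eq_of_lt s
    obtain ⟨K₂, h₂⟩ := exists_relabel_eq_of_lt t
    refine ⟨max K₁ K₂, fun m ρ τ h h' => ?_⟩
    simp only [rename]
    rw [h₁ ρ τ (fun a ha => h a (ha.trans_le (le_max_left _ _))) h',
      h₂ ρ τ (fun a ha => h a (ha.trans_le (le_max_right _ _))) h']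
  | rel R ts =>
    choose K hK using fun i => exists_relabel_eq_of_lt (ts i)
    refine ⟨Finset.univ.sup K, fun m ρ τ h₁ h₂ => ?_⟩
    simp only [rename]
    congr 1
    funext i
    exact hK i ρ τ (fun a ha => h₁ a (ha.trans_le (Finset.le_sup (Finset.mem_univ i)))) h₂
  | imp φ ψ h₁ h₂ =>
    obtain ⟨K₁, h₁⟩ := h₁
    obtain ⟨K₂, h₂⟩ := h₂
    refine ⟨max K₁ K₂, fun m ρ τ h h' => ?_⟩
    simp only [rename]
    rw [h₁.mono (le_max_left _ _) ρ τ h h', h₂.mono (le_max_right _ _) ρ τ h h']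
  | all φ h =>
    obtain ⟨K, hK⟩ := h
    refine ⟨K, fun m ρ τ h h' => congrArg BoundedFormula.all (hK _ _ (fun a ha => ?_) fun i => ?_)⟩
    · simp [h a ha]
    · refine Fin.lastCases ?_ (fun j => ?_) i <;> simp [h']

end Renaming

/-! ## Structural properties of derivability -/

section Structural

universe u v
variable {L : FirstOrder.Language.{u, v}}

theorem Derivable.mono {Γ Δ : Set (L.Formula ℕ)} {φ : L.Formula ℕ} (h : Derivable Γ φ)
    (hΔ : Γ ⊆ Δ) : Derivable Δ φ := by
  induction h generalizing Δ with
  | hyp h => exact .hyp (hΔ h)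
  | impIntro _ ih => exact .impIntro (ih (Set.insert_subset_insert hΔ))
  | impElim _ _ ih₁ ih₂ => exact .impElim (ih₁ hΔ) (ih₂ hΔ)
  | byContra _ ih => exact .byContra (ih (Set.insert_subset_insert hΔ))
  | allIntro _ ih => exact .allIntro (ih (Set.image_mono hΔ))
  | allElim t _ ih => exact .allElim t (ih hΔ)
  | eqRefl t => exact .eqRefl t
  | eqSubst φ _ _ ih₁ ih₂ => exact .eqSubst φ (ih₁ hΔ) (ih₂ hΔ)

/-- Derivations are finite. This makes the union of a chain of consistent sets consistent. -/
theorem Derivable.exists_finite {Γ : Set (L.Formula ℕ)} {φ : L.Formula ℕ} (h : Derivable Γ φ) :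
    ∃ Δ ⊆ Γ, Δ.Finite ∧ Derivable Δ φ := by
  have key : ∀ {Γ : Set (L.Formula ℕ)} {φ ψ : L.Formula ℕ},
      (∃ Δ ⊆ insert φ Γ, Δ.Finite ∧ Derivable Δ ψ) →
      ∃ Δ ⊆ Γ, Δ.Finite ∧ Derivable (insert φ Δ) ψ := by
    rintro Γ φ ψ ⟨Δ, h₁, h₂, h₃⟩
    refine ⟨Δ \ {φ}, by simpa [Set.sdiff_subset_iff] using h₁, h₂.sdiff, h₃.mono ?_⟩
    simp
  induction h with
  | hyp h => exact ⟨_, Set.singleton_subset_iff.2 h, Set.finite_singleton _, .hyp rfl⟩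
  | impIntro _ ih =>
    obtain ⟨Δ, h₁, h₂, h₃⟩ := key ih
    exact ⟨Δ, h₁, h₂, .impIntro h₃⟩
  | impElim _ _ ih₁ ih₂ =>
    obtain ⟨Δ₁, h₁, h₂, h₃⟩ := ih₁
    obtain ⟨Δ₂, k₁, k₂, k₃⟩ := ih₂
    exact ⟨_, Set.union_subset h₁ k₁, h₂.union k₂,
      .impElim (h₃.mono Set.subset_union_left) (k₃.mono Set.subset_union_right)⟩
  | byContra _ ih =>
    obtain ⟨Δ, h₁, h₂, h₃⟩ := key ih
    exact ⟨Δ, h₁, h₂, .byContra h₃⟩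
  | allIntro _ ih =>
    obtain ⟨Δ, h₁, h₂, h₃⟩ := ih
    -- A finite set of shifted hypotheses is the shift of a finite set of hypotheses.
    obtain ⟨Δ', k₁, k₂, rfl⟩ := Set.exists_subset_image_finite_and.1 ⟨Δ, h₁, h₂, rfl⟩
    exact ⟨Δ', k₁, k₂, .allIntro h₃⟩
  | allElim t _ ih =>
    obtain ⟨Δ, h₁, h₂, h₃⟩ := ih
    exact ⟨Δ, h₁, h₂, .allElim t h₃⟩
  | eqRefl t => exact ⟨∅, Set.empty_subset _, Set.finite_empty, .eqRefl t⟩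
  | eqSubst φ _ _ ih₁ ih₂ =>
    obtain ⟨Δ₁, h₁, h₂, h₃⟩ := ih₁
    obtain ⟨Δ₂, k₁, k₂, k₃⟩ := ih₂
    exact ⟨_, Set.union_subset h₁ k₁, h₂.union k₂,
      .eqSubst φ (h₃.mono Set.subset_union_left) (k₃.mono Set.subset_union_right)⟩

theorem Derivable.cut {Γ : Set (L.Formula ℕ)} {φ ψ : L.Formula ℕ} (h₁ : Derivable (insert φ Γ) ψ)
    (h₂ : Derivable Γ φ) : Derivable Γ ψ :=
  .impElim (.impIntro h₁) h₂

theorem Derivable.exfalso {Γ : Set (L.Formula ℕ)} {φ : L.Formula ℕ} (h : Derivable Γ ⊥) :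
    Derivable Γ φ :=
  .byContra (h.mono (Set.subset_insert _ _))

variable [L.IsRelational]

/-- The renaming need not be injective, since ∀-introduction is handled by applying the induction
hypothesis to `underFresh f`. As terms are variables, the two rules that instantiate terms commute
with renaming by `rename_inst`. -/
theorem Derivable.rename {Γ : Set (L.Formula ℕ)} {φ : L.Formula ℕ} (h : Derivable Γ φ)
    (f : ℕ → ℕ) : Derivable ((SetsAndFunctions.rename · (Sum.map f id)) '' Γ)
      (SetsAndFunctions.rename φ (Sum.map f id) : L.Formula ℕ) := by
  induction h generalizing f with
  | hyp h => exact .hyp (Set.mem_image_of_mem _ h)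
  | impIntro _ ih => exact .impIntro (by simpa [Set.image_insert_eq] using ih f)
  | impElim _ _ ih₁ ih₂ => exact .impElim (ih₁ f) (ih₂ f)
  | byContra _ ih =>
    have := ih f
    rw [Set.image_insert_eq] at this
    exact .byContra this
  | @allIntro Γ φ _ ih =>
    have := ih (underFresh f)
    rw [rename_instFresh, Set.image_image] at this
    simp only [rename_shift] at this
    simp only [SetsAndFunctions.rename, liftRen_map]
    refine .allIntro ?_
    rwa [Set.image_image]
  | @allElim Γ φ t _ ih =>
    cases t with
    | func F _ => exact isEmptyElim F
    | var k =>
      rw [rename_inst]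
      have := ih f
      simp only [SetsAndFunctions.rename, liftRen_map] at this
      exact .allElim _ this
  | eqRefl t => rw [rename_equal]; exact .eqRefl _
  | @eqSubst Γ s t φ _ _ ih₁ ih₂ =>
    cases s with
    | func F _ => exact isEmptyElim F
    | var j =>
    cases t with
    | func F _ => exact isEmptyElim F
    | var k =>
      rw [rename_inst]
      have e := ih₁ f
      have i := ih₂ f
      rw [rename_equal] at e
      simp only [rename_inst] at i
      exact .eqSubst (s := .var (f j)) (t := .var (f k)) _ e i

/-- Generalization over a variable that is not free in the hypotheses. -/
theorem Derivable.generalize {Γ : Set (L.Formula ℕ)} {φ : L.BoundedFormula ℕ 1} {K : ℕ}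
    (hΓ : ∀ ψ ∈ Γ, SupportedBelow ψ K) (hφ : SupportedBelow φ K)
    (h : Derivable Γ (inst φ (Term.var K))) : Derivable Γ φ.all := by
  -- On the variables below `K` this is the shift, and it sends the unused variable `K` to x₀.
  -- Variables above `K` do not occur, so their value 0 is irrelevant.
  have := h.rename fun k => if k < K then k + 1 else 0
  refine .allIntro ?_
  convert this using 1
  · refine Set.image_congr fun ψ hψ => ?_
    rw [shift, formula_relabel_eq_rename]
    exact hΓ ψ hψ _ _ (fun a ha => by simp [ha]) fun i => rfl
  · rw [instFresh_eq_rename, inst_var_eq_rename, rename_rename]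
    exact hφ _ _ (fun a ha => by simp [ha]) fun i => by simp

end Structural

/-! ## Completeness for countable relational languages -/

section Completeness

universe u v
variable {L : FirstOrder.Language.{u, v}}

/-- A maximal consistent set of formulas in which false universal statements have variables as
counterexamples. -/
structure IsHenkin (Γ : Set (L.Formula ℕ)) : Prop where
  consistent : ¬ Derivable Γ ⊥
  complete : ∀ φ : L.Formula ℕ, φ ∈ Γ ∨ φ.imp ⊥ ∈ Γ
  witness : ∀ ψ : L.BoundedFormula ℕ 1, (ψ.all.imp ⊥ : L.Formula ℕ) ∈ Γ →
    ∃ k : ℕ, (inst ψ (Term.var k)).imp ⊥ ∈ Γ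

/-- A consistent set of formulas with only finitely many free variables in total. -/
structure IsStage (Γ : Set (L.Formula ℕ)) : Prop where
  consistent : ¬ Derivable Γ ⊥
  bounded : ∃ K, ∀ ψ ∈ Γ, SupportedBelow ψ K

theorem IsStage.insert {Γ : Set (L.Formula ℕ)} (h : IsStage Γ) {φ : L.Formula ℕ}
    (hφ : ¬ Derivable (insert φ Γ) ⊥) : IsStage (insert φ Γ) := by
  obtain ⟨K, hK⟩ := h.bounded
  obtain ⟨K', hK'⟩ := exists_supportedBelow φ
  refine ⟨hφ, max K K', ?_⟩
  rintro ψ (rfl | hψ)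
  · exact hK'.mono (le_max_right _ _)
  · exact (hK ψ hψ).mono (le_max_left _ _)

theorem IsHenkin.mem_of_derivable {Γ : Set (L.Formula ℕ)} (h : IsHenkin Γ) {φ : L.Formula ℕ}
    (hφ : Derivable Γ φ) : φ ∈ Γ :=
  (h.complete φ).resolve_right fun hn => h.consistent (.impElim (.hyp hn) hφ)

theorem IsHenkin.imp_mem_iff {Γ : Set (L.Formula ℕ)} (h : IsHenkin Γ) {φ ψ : L.Formula ℕ} :
    φ.imp ψ ∈ Γ ↔ (φ ∈ Γ → ψ ∈ Γ) := by
  refine ⟨fun h₁ h₂ => h.mem_of_derivable (.impElim (.hyp h₁) (.hyp h₂)), fun hi => ?_⟩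
  rcases h.complete φ with hφ | hφ
  · exact h.mem_of_derivable (.impIntro (.hyp (.inr (hi hφ))))
  · exact h.mem_of_derivable (.impIntro
      (.exfalso (.impElim (.hyp (.inr hφ)) (.hyp (Set.mem_insert _ _)))))

theorem IsHenkin.all_mem_iff {Γ : Set (L.Formula ℕ)} (h : IsHenkin Γ)
    {ψ : L.BoundedFormula ℕ 1} :
    (ψ.all : L.Formula ℕ) ∈ Γ ↔ ∀ k : ℕ, inst ψ (Term.var k) ∈ Γ := by
  refine ⟨fun h₁ k => h.mem_of_derivable (.allElim _ (.hyp h₁)), fun hi => ?_⟩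
  refine (h.complete _).resolve_right fun hn => ?_
  obtain ⟨k, hk⟩ := h.witness ψ hn
  exact h.consistent (.impElim (.hyp hk) (.hyp (hi k)))

/-- The two renamings differ at one variable only. Binding that variable yields a formula of which
both renamings are instances, and the substitution rule for equality passes between them. -/
theorem IsHenkin.rename_mem_of_eq_off {Γ : Set (L.Formula ℕ)} (h : IsHenkin Γ) (φ : L.Formula ℕ)
    {f g : ℕ → ℕ} {k : ℕ} (hfg : ∀ i, i ≠ k → f i = g i)
    (hk : (Term.var (f k)).equal (Term.var (g k)) ∈ Γ)
    (hf : (rename φ (Sum.map f id) : L.Formula ℕ) ∈ Γ) :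
    (rename φ (Sum.map g id) : L.Formula ℕ) ∈ Γ := by
  have key : ∀ f' : ℕ → ℕ, (∀ i, i ≠ k → f' i = f i) →
      inst (rename φ (Sum.elim (fun i => if i = k then Sum.inr 0 else Sum.inl (f i)) Fin.elim0))
        (Term.var (f' k)) = (rename φ (Sum.map f' id) : L.Formula ℕ) := by
    intro f' hf'
    rw [inst_var_eq_rename, rename_rename]
    congr 1
    funext x
    rcases x with i | i
    · by_cases hi : i = k
      · simp [hi]
      · simp [hi, hf' i hi]
    · exact i.elim0
  rw [← key g fun i hi => (hfg i hi).symm]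
  exact h.mem_of_derivable (.eqSubst _ (.hyp hk) (by rw [key f fun _ _ => rfl]; exact .hyp hf))

/-- Provable equality of variables. -/
def IsHenkin.setoid {Γ : Set (L.Formula ℕ)} (h : IsHenkin Γ) : Setoid ℕ where
  r i j := (Term.var i : L.Term ℕ).equal (Term.var j) ∈ Γ
  iseqv := by
    -- Applied to x₀ = x₁, replacing the image of x₀ gives symmetry and replacing that of x₁ gives
    -- transitivity.
    have key : ∀ {f g : ℕ → ℕ} (k : ℕ), (∀ i, i ≠ k → f i = g i) →
        (Term.var (f k) : L.Term ℕ).equal (Term.var (g k)) ∈ Γ →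
        (Term.var (f 0) : L.Term ℕ).equal (Term.var (f 1)) ∈ Γ →
        (Term.var (g 0) : L.Term ℕ).equal (Term.var (g 1)) ∈ Γ := by
      intro f g k h₁ h₂ h₃
      have := h.rename_mem_of_eq_off ((Term.var 0).equal (Term.var 1)) h₁ h₂
      rw [rename_equal, rename_equal] at this
      exact this h₃
    have hr : ∀ i, (Term.var i : L.Term ℕ).equal (Term.var i) ∈ Γ := fun i =>
      h.mem_of_derivable (.eqRefl _)
    refine ⟨hr, fun {i j} hij => ?_, fun {i j k} hij hjk => ?_⟩
    · exact key (f := fun _ => i) (g := fun n => if n = 0 then j else i) 0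
        (fun n hn => by simp [hn]) (by simpa using hij) (hr i)
    · exact key (f := fun n => if n = 1 then j else i) (g := fun n => if n = 1 then k else i) 1
        (fun n hn => by simp [hn]) (by simpa using hjk) (by simpa using hij)

theorem IsHenkin.setoid_apply {Γ : Set (L.Formula ℕ)} (h : IsHenkin Γ) {i j : ℕ} :
    h.setoid i j ↔ (Term.var i : L.Term ℕ).equal (Term.var j) ∈ Γ := Iff.rfl

theorem IsHenkin.rename_mem {Γ : Set (L.Formula ℕ)} (h : IsHenkin Γ) (φ : L.Formula ℕ)
    {f g : ℕ → ℕ} (hfg : ∀ i, h.setoid (f i) (g i))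
    (hf : (rename φ (Sum.map f id) : L.Formula ℕ) ∈ Γ) :
    (rename φ (Sum.map g id) : L.Formula ℕ) ∈ Γ := by
  obtain ⟨K, hK⟩ := exists_supportedBelow φ
  -- The images are exchanged one variable at a time; after `K` exchanges all variables that occur
  -- are done.
  have key : ∀ m : ℕ, (rename φ (Sum.map (fun i => if i < m then g i else f i) id)
      : L.Formula ℕ) ∈ Γ := by
    intro m
    induction m with
    | zero => simpa using hf
    | succ m ih =>
      refine h.rename_mem_of_eq_off φ (k := m) (fun i hi => ?_) ?_ ih
      · have : i < m ↔ i < m + 1 := by omega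
        simp [this]
      · simpa [h.setoid_apply] using hfg m
  have he := hK (Sum.map (fun i => if i < K then g i else f i) (id : Fin 0 → Fin 0))
    (Sum.map g id) (fun a ha => by simp [ha]) fun i => rfl
  exact he ▸ key K

theorem IsHenkin.relation_mem {Γ : Set (L.Formula ℕ)} (h : IsHenkin Γ) {l : ℕ}
    (R : L.Relations l) {x y : Fin l → ℕ} (hxy : ∀ i, h.setoid (x i) (y i))
    (hx : R.formula (fun i => Term.var (x i)) ∈ Γ) : R.formula (fun i => Term.var (y i)) ∈ Γ := by
  have key : ∀ z : Fin l → ℕ, (rename (R.formula fun i : Fin l => Term.var (i : ℕ))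
      (Sum.map (fun n => if hn : n < l then z ⟨n, hn⟩ else 0) id) : L.Formula ℕ)
      = R.formula fun i => Term.var (z i) := by
    intro z
    simp [Relations.formula, Relations.boundedFormula, rename]
  rw [← key] at hx ⊢
  refine h.rename_mem _ (fun i => ?_) hx
  by_cases hi : i < l
  · simpa [hi] using hxy ⟨i, hi⟩
  · simp [hi]

variable [L.IsRelational]

/-- One step of the Henkin construction: decide `φ` and, if a negated universal statement was added,
add a counterexample at a variable `K` that is still unused. If this made the set inconsistent, the
instance at `K` would be derivable, hence by `generalize` the universal statement, against the
consistency of its negation. -/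
theorem IsStage.exists_step {Γ : Set (L.Formula ℕ)} (h : IsStage Γ) (φ : L.Formula ℕ) :
    ∃ Γ', Γ ⊆ Γ' ∧ IsStage Γ' ∧ (φ ∈ Γ' ∨ φ.imp ⊥ ∈ Γ') ∧
      ∀ ψ : L.BoundedFormula ℕ 1, φ = ψ.all.imp ⊥ → φ ∈ Γ' →
        ∃ k : ℕ, (inst ψ (Term.var k)).imp ⊥ ∈ Γ' := by
  by_cases hφ : Derivable (Insert.insert φ Γ) ⊥
  · have hc : ¬ Derivable (Insert.insert (φ.imp ⊥) Γ) ⊥ := fun hn =>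
      h.consistent (hφ.cut (.byContra hn))
    refine ⟨_, Set.subset_insert _ _, h.insert hc, .inr (Set.mem_insert _ _), fun ψ _ hm => ?_⟩
    exact absurd (hφ.mono (Set.insert_subset hm (Set.subset_insert _ _))) hc
  · have h₁ := h.insert hφ
    by_cases hex : ∃ ψ : L.BoundedFormula ℕ 1, φ = ψ.all.imp ⊥
    · obtain ⟨ψ, rfl⟩ := hex
      obtain ⟨K₁, hK₁⟩ := h₁.bounded
      obtain ⟨K₂, hK₂⟩ := exists_supportedBelow ψ
      set K := max K₁ K₂
      have hc : ¬ Derivable (Insert.insert ((inst ψ (Term.var K)).imp ⊥)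
          (Insert.insert (ψ.all.imp ⊥ : L.Formula ℕ) Γ)) ⊥ := by
        intro hn
        refine hφ (.impElim (.hyp (Set.mem_insert _ _)) (Derivable.generalize (K := K) ?_ ?_
          (.byContra hn)))
        · exact fun χ hχ => (hK₁ χ hχ).mono (le_max_left _ _)
        · exact hK₂.mono (le_max_right _ _)
      refine ⟨_, (Set.subset_insert _ _).trans (Set.subset_insert _ _), h₁.insert hc,
        .inl (.inr (Set.mem_insert _ _)), fun ψ' he _ => ⟨K, ?_⟩⟩
      obtain rfl : ψ = ψ' := by injection he with _ he; injection he
      exact Set.mem_insert _ _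
    · exact ⟨_, Set.subset_insert _ _, h₁, .inl (Set.mem_insert _ _),
        fun ψ he _ => absurd ⟨ψ, he⟩ hex⟩

/-- Countability allows all formulas to be decided in one sequence of stages, each with unused
variables left. A contradiction from the union would use finitely many formulas and so appear at
some stage. -/
theorem IsStage.exists_isHenkin [Countable L.Symbols] {Γ : Set (L.Formula ℕ)} (h : IsStage Γ) :
    ∃ Δ, Γ ⊆ Δ ∧ IsHenkin Δ := by
  obtain ⟨e, he⟩ := exists_surjective_nat (L.Formula ℕ)
  choose next hsub hstage hdec hwit using
    fun (Γ : {Γ : Set (L.Formula ℕ) // IsStage Γ}) φ => Γ.2.exists_step φ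
  let G : ℕ → {Γ : Set (L.Formula ℕ) // IsStage Γ} := fun n =>
    Nat.rec ⟨Γ, h⟩ (fun n Γ => ⟨next Γ (e n), hstage Γ (e n)⟩) n
  have hmono : Monotone fun n => (G n).1 := monotone_nat_of_le_succ fun n => hsub (G n) (e n)
  have hle : ∀ n, (G n).1 ⊆ ⋃ n, (G n).1 := fun n => Set.subset_iUnion (fun n => (G n).1) n
  have hcon : ¬ Derivable (⋃ n, (G n).1) ⊥ := by
    intro hd
    obtain ⟨Δ, h₁, h₂, h₃⟩ := hd.exists_finite
    obtain ⟨n, hn⟩ := hmono.directed_le.exists_mem_subset_of_finset_subset_biUnion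
      (s := h₂.toFinset) (by simpa using h₁)
    exact (G n).2.consistent (h₃.mono (by simpa using hn))
  refine ⟨⋃ n, (G n).1, hle 0, hcon, fun φ => ?_, fun ψ hψ => ?_⟩
  · obtain ⟨n, rfl⟩ := he φ
    exact (hdec (G n) (e n)).imp (fun h => hle (n + 1) h) fun h => hle (n + 1) h
  · obtain ⟨n, hn⟩ := he (ψ.all.imp ⊥)
    have hm : e n ∈ (G (n + 1)).1 := by
      rcases hdec (G n) (e n) with h | h
      · exact h
      · have h' := hle (n + 1) h
        rw [hn] at h'
        exact absurd (.impElim (.hyp h') (.hyp hψ)) hcon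
    obtain ⟨k, hk⟩ := hwit (G n) (e n) ψ hn hm
    exact ⟨k, hle (n + 1) hk⟩

/-- The model whose elements are the variables up to provable equality. -/
@[reducible] def IsHenkin.structure {Γ : Set (L.Formula ℕ)} (h : IsHenkin Γ) :
    L.Structure (Quotient h.setoid) where
  funMap F := isEmptyElim F
  -- Relations are read off at chosen representatives; `relation_mem` makes the choice irrelevant.
  RelMap R xs := R.formula (fun i => Term.var (xs i).out) ∈ Γ

/-- The truth lemma. Making the variables bound in scope free along `ρ` lets the induction go below
quantifiers; since every element is the class of a variable, the Henkin witnesses settle the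
universal case. -/
theorem IsHenkin.rename_mem_iff_realize {Γ : Set (L.Formula ℕ)} (h : IsHenkin Γ) {n : ℕ}
    (φ : L.BoundedFormula ℕ n) (ρ : ℕ ⊕ Fin n → ℕ) :
    let _ := h.structure
    (rename φ (Sum.inl ∘ ρ) : L.Formula ℕ) ∈ Γ ↔
      φ.Realize (fun i => (Quotient.mk h.setoid (ρ (Sum.inl i))))
        (fun i => (Quotient.mk h.setoid (ρ (Sum.inr i)))) := by
  let _ := h.structure
  have ht : ∀ {n : ℕ} (t : L.Term (ℕ ⊕ Fin n)), ∃ x, t = .var x := by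
    intro n t
    cases t with
    | var x => exact ⟨x, rfl⟩
    | func F _ => exact isEmptyElim F
  induction φ with
  | falsum => exact ⟨fun hm => h.consistent (.hyp hm), False.elim⟩
  | equal s t =>
    obtain ⟨x, rfl⟩ := ht s
    obtain ⟨y, rfl⟩ := ht t
    have : ∀ x, Term.realize (Sum.elim (fun i => Quotient.mk h.setoid (ρ (Sum.inl i)))
        (fun i => Quotient.mk h.setoid (ρ (Sum.inr i)))) (.var x : L.Term _)
        = Quotient.mk h.setoid (ρ x) := by rintro (x | x) <;> rfl
    simp only [BoundedFormula.Realize, this]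
    exact (Quotient.eq (r := h.setoid) (x := ρ x) (y := ρ y)).symm
  | rel R ts =>
    choose x hx using fun i => ht (ts i)
    obtain rfl : ts = fun i => .var (x i) := funext hx
    have he : (rename (.rel R fun i => .var (x i)) (Sum.inl ∘ ρ) : L.Formula ℕ)
        = R.formula fun i => .var (ρ (x i)) := rfl
    have hr : ∀ x, Term.realize (Sum.elim (fun i => Quotient.mk h.setoid (ρ (Sum.inl i)))
        (fun i => Quotient.mk h.setoid (ρ (Sum.inr i)))) (.var x : L.Term _)
        = Quotient.mk h.setoid (ρ x) := by rintro (x | x) <;> rfl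
    rw [he]
    simp only [BoundedFormula.Realize, hr]
    have ho : ∀ i, h.setoid (Quotient.mk h.setoid (ρ (x i))).out (ρ (x i)) := fun i =>
      Quotient.mk_out (s := h.setoid) _
    exact ⟨h.relation_mem R fun i => h.setoid.symm (ho i), h.relation_mem R ho⟩
  | imp φ ψ h₁ h₂ => exact h.imp_mem_iff.trans (imp_congr (h₁ ρ) (h₂ ρ))
  | all φ ih =>
    refine h.all_mem_iff.trans ?_
    rw [BoundedFormula.realize_all, (Quotient.mk_surjective (s := h.setoid)).forall]
    refine forall_congr' fun k => ?_
    rw [inst_var_eq_rename, rename_rename]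
    convert ih (Sum.elim (fun a => ρ (Sum.inl a)) (Fin.lastCases k fun j => ρ (Sum.inr j)))
      using 2
    · congr 1
      funext x
      rcases x with a | i
      · rfl
      · refine Fin.lastCases ?_ (fun j => ?_) i <;> simp
    · rfl
    · funext i
      refine Fin.lastCases ?_ (fun j => ?_) i <;> simp

/-- Gödel's completeness theorem for countable relational languages. -/
theorem exists_model_of_consistent {L : FirstOrder.Language.{0, 0}} [L.IsRelational]
    [Countable L.Symbols] {T : L.Theory} (h : Consistent T) :
    ∃ (M : Type) (_ : L.Structure M), Nonempty M ∧ M ⊨ T := by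
  have hs : IsStage
      ((fun τ : L.Sentence => Formula.relabel Empty.elim τ : _ → L.Formula ℕ) '' T) := by
    -- Sentences have no free variables, so the bound 0 serves for all of them.
    refine ⟨h, 0, ?_⟩
    rintro _ ⟨σ, -, rfl⟩ m ρ τ - -
    simp only [formula_relabel_eq_rename, rename_rename]
    congr 1
    funext x
    rcases x with a | i
    · exact a.elim
    · exact i.elim0
  obtain ⟨Δ, hΔ, hH⟩ := hs.exists_isHenkin
  let _ := hH.structure
  refine ⟨Quotient hH.setoid, hH.structure, ⟨Quotient.mk _ 0⟩, ⟨fun σ hσ => ?_⟩⟩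
  have hm := hΔ (Set.mem_image_of_mem _ hσ)
  have he : (Formula.relabel Empty.elim σ : L.Formula ℕ)
      = rename (Formula.relabel Empty.elim σ : L.Formula ℕ)
        (Sum.inl ∘ (Sum.elim id Fin.elim0 : ℕ ⊕ Fin 0 → ℕ)) := by
    rw [formula_relabel_eq_rename, rename_rename]
    congr 1
    funext x
    rcases x with a | i
    · exact a.elim
    · exact i.elim0
  beta_reduce at hm
  rw [he] at hm
  have := Formula.realize_relabel.1 (Formula.boundedFormula_realize_eq_realize _ _ _ |>.1
    ((hH.rename_mem_iff_realize _ _).1 hm))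
  rw [Sentence.Realize]
  convert this using 1

end Completeness

/-! ## Soundness -/

section Soundness

universe u v w
variable {L : FirstOrder.Language.{u, v}} {M : Type w} [L.Structure M]

theorem realize_inst (φ : L.BoundedFormula ℕ 1) (t : L.Term ℕ) (v : ℕ → M) :
    (inst φ t).Realize v ↔ φ.Realize v ![t.realize v] := by
  rw [inst, Formula.Realize, BoundedFormula.realize_subst]
  refine (BoundedFormula.realize_toFormula φ _).trans (iff_of_eq ?_)
  congr 1
  funext i
  fin_cases i
  rfl

theorem realize_instFresh (φ : L.BoundedFormula ℕ 1) (v : ℕ → M) :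
    (instFresh φ).Realize v ↔ φ.Realize (fun n => v (n + 1)) ![v 0] := by
  rw [instFresh, Formula.realize_relabel]
  refine (BoundedFormula.realize_toFormula φ _).trans (iff_of_eq ?_)
  congr 1
  funext i
  fin_cases i
  rfl

theorem Derivable.sound {Γ : Set (L.Formula ℕ)} {φ : L.Formula ℕ} (h : Derivable Γ φ)
    (v : ℕ → M) (hv : ∀ ψ ∈ Γ, Formula.Realize ψ v) : φ.Realize v := by
  induction h generalizing v with
  | hyp h => exact hv _ h
  | impIntro _ ih =>
    exact fun hφ => ih v (by
      rintro ψ (rfl | hψ)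
      · exact hφ
      · exact hv ψ hψ)
  | impElim _ _ ih₁ ih₂ => exact ih₁ v hv (ih₂ v hv)
  | byContra _ ih =>
    by_contra hn
    exact ih v (by
      rintro ψ (rfl | hψ)
      · exact hn
      · exact hv ψ hψ)
  | @allIntro Γ φ _ ih =>
    intro x
    have := (realize_instFresh φ _).1 (ih (fun n => Nat.casesOn n x v) (by
      rintro _ ⟨ψ, hψ, rfl⟩
      exact Formula.realize_relabel.2 (hv ψ hψ)))
    convert this using 1
    funext i
    fin_cases i
    rfl
  | @allElim Γ φ t _ ih =>
    rw [realize_inst]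
    convert ih v hv (t.realize v) using 1
    funext i
    fin_cases i
    rfl
  | eqRefl t => simp
  | @eqSubst Γ s t φ _ _ ih₁ ih₂ =>
    have h₁ := Formula.realize_equal.1 (ih₁ v hv)
    have h₂ := ih₂ v hv
    rw [realize_inst] at h₂ ⊢
    rwa [← h₁]

theorem consistent_of_model {T : L.Theory} [Nonempty M] (h : M ⊨ T) : Consistent T := by
  intro hp
  obtain ⟨x⟩ := ‹Nonempty M›
  refine hp.sound (fun _ => x) ?_
  rintro _ ⟨σ, hσ, rfl⟩
  refine Formula.realize_relabel.2 ?_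
  have := h.realize_of_mem σ hσ
  rwa [Sentence.Realize, Subsingleton.elim default] at this

end Soundness

/-! ## Predicates definable with parameters, transported along a surjection -/

section Definability

variable {L : FirstOrder.Language.{0, 0}} {M N : Type} [L.Structure M] {r : M → N} {β γ : Type}

variable (L) in
/-- The pullback along `r` of the predicate `P` on `β`-tuples is definable with parameters. -/
def Dfn (r : M → N) (P : (β → N) → Prop) : Prop :=
  ∃ φ : L.Formula (M ⊕ β), ∀ w : β → M, φ.Realize (Sum.elim id w) ↔ P fun i => r (w i)

/-- A coordinate function or a constant. -/
def IsCoord (f : (β → N) → N) : Prop :=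
  (∃ i, ∀ w, f w = w i) ∨ ∃ a, ∀ w, f w = a

theorem IsCoord.var (i : β) : IsCoord fun w : β → N => w i := .inl ⟨i, fun _ => rfl⟩

theorem IsCoord.const (a : N) : IsCoord fun _ : β → N => a := .inr ⟨a, fun _ => rfl⟩

theorem Dfn.imp {P Q : (β → N) → Prop} (hP : Dfn L r P) (hQ : Dfn L r Q) :
    Dfn L r fun w => P w → Q w := by
  obtain ⟨φ, hφ⟩ := hP
  obtain ⟨ψ, hψ⟩ := hQ
  exact ⟨φ.imp ψ, fun w => imp_congr (hφ w) (hψ w)⟩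

theorem Dfn.false : Dfn L r fun _ : β → N => False :=
  ⟨⊥, fun _ => Iff.rfl⟩

theorem Dfn.congr {P Q : (β → N) → Prop} (hP : Dfn L r P) (h : ∀ w, P w ↔ Q w) : Dfn L r Q := by
  rwa [← show P = Q from funext fun w => propext (h w)]

theorem Dfn.not {P : (β → N) → Prop} (hP : Dfn L r P) : Dfn L r fun w => ¬ P w :=
  hP.imp .false

theorem Dfn.and {P Q : (β → N) → Prop} (hP : Dfn L r P) (hQ : Dfn L r Q) :
    Dfn L r fun w => P w ∧ Q w :=
  (hP.imp hQ.not).not.congr fun w => by tauto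

theorem Dfn.or {P Q : (β → N) → Prop} (hP : Dfn L r P) (hQ : Dfn L r Q) :
    Dfn L r fun w => P w ∨ Q w :=
  (hP.not.imp hQ).congr fun w => by tauto

theorem Dfn.iff {P Q : (β → N) → Prop} (hP : Dfn L r P) (hQ : Dfn L r Q) :
    Dfn L r fun w => P w ↔ Q w :=
  ((hP.imp hQ).and (hQ.imp hP)).congr fun w => by tauto

/-- By surjectivity of `r`, a quantifier over `N` can be replaced by one over `M`; `none` is the
newly bound variable. -/
theorem Dfn.all (hr : Function.Surjective r) {P : (β → N) → N → Prop}
    (hP : Dfn L r fun w : Option β → N => P (fun i => w (some i)) (w none)) :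
    Dfn L r fun w => ∀ x, P w x := by
  obtain ⟨φ, hφ⟩ := hP
  let g : M ⊕ Option β → (M ⊕ β) ⊕ Fin 1 :=
    Sum.elim (fun a => Sum.inl (Sum.inl a)) fun o => o.elim (Sum.inr 0) fun i => Sum.inl (Sum.inr i)
  refine ⟨(BoundedFormula.relabel g φ).all, fun w => ?_⟩
  refine Iff.trans ?_ hr.forall.symm
  rw [Formula.Realize, BoundedFormula.realize_all]
  refine forall_congr' fun a => ?_
  rw [BoundedFormula.realize_relabel]
  refine Iff.trans (iff_of_eq ?_) (hφ fun o => o.elim a w)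
  rw [Formula.Realize]
  congr 1
  · funext x
    rcases x with x | _ | x <;> rfl
  · exact Subsingleton.elim _ _

theorem Dfn.ex (hr : Function.Surjective r) {P : (β → N) → N → Prop}
    (hP : Dfn L r fun w : Option β → N => P (fun i => w (some i)) (w none)) :
    Dfn L r fun w => ∃ x, P w x :=
  (Dfn.all hr (P := fun w x => ¬ P w x) hP.not).not.congr fun w => by simp

/-- A constant from `N` becomes a parameter, namely any of its preimages under `r`. -/
theorem Dfn.subst (hr : Function.Surjective r) {P : (γ → N) → Prop} (hP : Dfn L r P)
    {τ : γ → (β → N) → N} (hτ : ∀ c, IsCoord (τ c)) : Dfn L r fun w => P fun c => τ c w := by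
  obtain ⟨φ, hφ⟩ := hP
  have : ∀ c, ∃ s : M ⊕ β, ∀ w : β → M, τ c (fun i => r (w i)) = r (Sum.elim id w s) := by
    intro c
    rcases hτ c with ⟨i, hi⟩ | ⟨a, ha⟩
    · exact ⟨.inr i, fun w => hi _⟩
    · obtain ⟨m, rfl⟩ := hr a
      exact ⟨.inl m, fun w => ha _⟩
  choose s hs using this
  refine ⟨φ.relabel (Sum.elim Sum.inl s), fun w => ?_⟩
  rw [Formula.realize_relabel]
  simp only [hs]
  refine Iff.trans (iff_of_eq ?_) (hφ fun c => Sum.elim id w (s c))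
  congr 1
  funext x
  rcases x with x | x <;> rfl

variable (L) in
/-- Definability of a unary predicate. -/
abbrev Dfn₁ (r : M → N) (P : N → Prop) : Prop := Dfn L r fun w : Fin 1 → N => P (w 0)

variable (L) in
/-- Definability of a binary relation. -/
abbrev Dfn₂ (r : M → N) (P : N → N → Prop) : Prop := Dfn L r fun w : Fin 2 → N => P (w 0) (w 1)

variable (L) in
/-- Definability of a ternary relation. -/
abbrev Dfn₃ (r : M → N) (P : N → N → N → Prop) : Prop :=
  Dfn L r fun w : Fin 3 → N => P (w 0) (w 1) (w 2)

theorem Dfn₁.app (hr : Function.Surjective r) {P : N → Prop} (hP : Dfn₁ L r P)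
    {a : (β → N) → N} (ha : IsCoord a) : Dfn L r fun w => P (a w) :=
  Dfn.subst hr hP (τ := ![a]) fun c => by fin_cases c; exact ha

theorem Dfn₂.app (hr : Function.Surjective r) {P : N → N → Prop} (hP : Dfn₂ L r P)
    {a b : (β → N) → N} (ha : IsCoord a) (hb : IsCoord b) : Dfn L r fun w => P (a w) (b w) :=
  Dfn.subst hr hP (τ := ![a, b]) fun c => by
    fin_cases c
    · exact ha
    · exact hb

theorem Dfn₃.app (hr : Function.Surjective r) {P : N → N → N → Prop} (hP : Dfn₃ L r P)
    {a b c : (β → N) → N} (ha : IsCoord a) (hb : IsCoord b) (hc : IsCoord c) :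
    Dfn L r fun w => P (a w) (b w) (c w) :=
  Dfn.subst hr hP (τ := ![a, b, c]) fun i => by
    fin_cases i
    · exact ha
    · exact hb
    · exact hc

/-- Only finitely many elements of `M` occur in a formula. Numbering them brings a definable
predicate into the form of the schemata, whose parameters are indexed by `Fin m`. -/
theorem Dfn.exists_params [Nonempty M] {j : ℕ} {P : (Fin j → N) → Prop} (hP : Dfn L r P) :
    ∃ (m : ℕ) (φ : L.Formula (Fin m ⊕ Fin j)) (p : Fin m → M), ∀ w : Fin j → M,
      φ.Realize (Sum.elim p w) ↔ P fun i => r (w i) := by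
  classical
  obtain ⟨φ, hφ⟩ := hP
  let e := φ.freeVarFinset.equivFin
  let g : φ.freeVarFinset → Fin _ ⊕ Fin j := fun x => Sum.elim (fun _ => Sum.inl (e x)) Sum.inr x.1
  -- All free variables are numbered, including the distinguished ones; the indices of the latter go
  -- unused and get an arbitrary element.
  let p : Fin _ → M := fun i => Sum.elim id (fun _ => Classical.arbitrary M) (e.symm i).1
  refine ⟨_, φ.restrictFreeVar g, p, fun w => ?_⟩
  refine Iff.trans ?_ (hφ w)
  refine BoundedFormula.realize_restrictFreeVar (Sum.elim id w) ?_
  rintro ⟨x, hx⟩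
  rcases x with x | x <;> simp [g, p]

end Definability

/-! ## Models of ZF -/

section ZFModels

variable {M : Type} [LZF.Structure M]

/-- Membership in a model of set theory. -/
def Mem (a b : M) : Prop := Structure.RelMap (L := LZF) (n := 2) ZFRel.mem ![a, b]

theorem realize_zmem {α : Type} {n : ℕ} (a b : LZF.Term (α ⊕ Fin n)) (v : α → M)
    (xs : Fin n → M) : (zmem a b).Realize v xs ↔
      Mem (a.realize (Sum.elim v xs)) (b.realize (Sum.elim v xs)) := by
  change Structure.RelMap (L := LZF) (n := 2) ZFRel.mem
    (fun i => ((![a, b] : Fin 2 → LZF.Term _) i).realize (Sum.elim v xs)) ↔ _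
  rw [Mem]
  refine iff_of_eq (congrArg _ ?_)
  funext i
  fin_cases i <;> rfl

theorem realize_closure {L : FirstOrder.Language.{0, 0}} {M : Type} [L.Structure M] {m : ℕ}
    (φ : L.Formula (Fin m)) : M ⊨ SetsAndFunctions.closure φ ↔ ∀ p : Fin m → M, φ.Realize p := by
  rw [SetsAndFunctions.closure, Sentence.Realize, BoundedFormula.realize_alls]
  refine forall_congr' fun p => ?_
  exact Formula.realize_relabel_sumInr φ

theorem realize_at' {L : FirstOrder.Language.{0, 0}} {M : Type} [L.Structure M] {m j d : ℕ}
    (φ : L.Formula (Fin m ⊕ Fin j)) (w : Fin j → Fin d) (p : Fin m → M) (xs : Fin d → M) :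
    (at' φ w).Realize p xs ↔ φ.Realize (Sum.elim p fun i => xs (w i)) := by
  rw [at']
  refine BoundedFormula.realize_relabel.trans (iff_of_eq ?_)
  rw [Formula.Realize]
  congr 1
  · funext x
    rcases x with x | x <;> rfl
  · exact Subsingleton.elim _ _

theorem realize_at'_one {L : FirstOrder.Language.{0, 0}} {M : Type} [L.Structure M] {m d : ℕ}
    (φ : L.Formula (Fin m ⊕ Fin 1)) (a : Fin d) (p : Fin m → M) (xs : Fin d → M) :
    (at' φ ![a]).Realize p xs ↔ φ.Realize (Sum.elim p ![xs a]) := by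
  rw [realize_at']
  refine iff_of_eq (congrArg (fun w => φ.Realize (Sum.elim p w)) ?_)
  funext i
  fin_cases i
  rfl

theorem realize_at'_two {L : FirstOrder.Language.{0, 0}} {M : Type} [L.Structure M] {m d : ℕ}
    (φ : L.Formula (Fin m ⊕ Fin 2)) (a b : Fin d) (p : Fin m → M) (xs : Fin d → M) :
    (at' φ ![a, b]).Realize p xs ↔ φ.Realize (Sum.elim p ![xs a, xs b]) := by
  rw [realize_at']
  refine iff_of_eq (congrArg (fun w => φ.Realize (Sum.elim p w)) ?_)
  funext i
  fin_cases i <;> rfl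

variable (M) in
/-- The content of the ZF axioms in a model. -/
structure ZFModel : Prop where
  ext : ∀ x y : M, (∀ z, Mem z x ↔ Mem z y) → x = y
  empty : ∃ x : M, ∀ y, ¬ Mem y x
  pair : ∀ x y : M, ∃ z, ∀ w, Mem w z ↔ w = x ∨ w = y
  union : ∀ x : M, ∃ y, ∀ z, Mem z y ↔ ∃ w, Mem w x ∧ Mem z w
  power : ∀ x : M, ∃ y, ∀ z, Mem z y ↔ ∀ w, Mem w z → Mem w x
  infinity : ∃ x : M, (∃ e, (∀ y, ¬ Mem y e) ∧ Mem e x) ∧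
    ∀ y, Mem y x → ∃ z, Mem z x ∧ ∀ w, Mem w z ↔ Mem w y ∨ w = y
  regularity : ∀ x : M, (∃ y, Mem y x) → ∃ y, Mem y x ∧ ∀ z, Mem z y → ¬ Mem z x
  separation : ∀ P : M → Prop, Dfn₁ LZF id P → ∀ x, ∃ y, ∀ z, Mem z y ↔ Mem z x ∧ P z
  replacement : ∀ R : M → M → Prop, Dfn₂ LZF id R → ∀ x,
    (∀ y, Mem y x → ∃ z, R y z ∧ ∀ z', R y z' → z' = z) →
      ∃ z, ∀ w, Mem w z ↔ ∃ y, Mem y x ∧ R y w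

theorem zfModel_of_models [Nonempty M] (h : M ⊨ ZF) : ZFModel M := by
  have h0 : ∀ σ ∈ ({zfExtensionality, zfEmpty, zfPairing, zfUnion, zfPower, zfInfinity,
      zfRegularity} : Set LZF.Sentence), M ⊨ σ := fun σ hσ =>
    h.realize_of_mem σ (.inl (.inl hσ))
  constructor
  · simpa [zfExtensionality, Sentence.Realize, Formula.Realize, realize_zmem, Fin.snoc]
      using h0 zfExtensionality (by simp)
  · simpa [zfEmpty, Sentence.Realize, Formula.Realize, realize_zmem, Fin.snoc]
      using h0 zfEmpty (by simp)
  · simpa [zfPairing, Sentence.Realize, Formula.Realize, realize_zmem, Fin.snoc]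
      using h0 zfPairing (by simp)
  · simpa [zfUnion, Sentence.Realize, Formula.Realize, realize_zmem, Fin.snoc]
      using h0 zfUnion (by simp)
  · simpa [zfPower, Sentence.Realize, Formula.Realize, realize_zmem, Fin.snoc]
      using h0 zfPower (by simp)
  · simpa [zfInfinity, Sentence.Realize, Formula.Realize, realize_zmem, Fin.snoc]
      using h0 zfInfinity (by simp)
  · simpa [zfRegularity, Sentence.Realize, Formula.Realize, realize_zmem, Fin.snoc]
      using h0 zfRegularity (by simp)
  · intro P hP
    obtain ⟨m, φ, p, hφ⟩ := hP.exists_params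
    have := (realize_closure _).1 (h.realize_of_mem (zfSeparation φ) (.inl (.inr ⟨m, φ, rfl⟩))) p
    rw [Formula.Realize] at this
    simpa [realize_zmem, Fin.snoc, realize_at'_one, realize_at'_two, hφ] using this
  · intro R hR
    obtain ⟨m, φ, p, hφ⟩ := hR.exists_params
    have := (realize_closure _).1 (h.realize_of_mem (zfReplacement φ) (.inr ⟨m, φ, rfl⟩)) p
    rw [Formula.Realize] at this
    simpa [realize_zmem, Fin.snoc, realize_at'_one, realize_at'_two, hφ] using this

end ZFModels

/-! ## Pairs and tuples -/

section Tuples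

variable {N : Type} (E : N → N → Prop) (S : N → Prop)

/-- `p` is a set with exactly the elements `a` and `b`. -/
def IsPair (p a b : N) : Prop := S p ∧ ∀ z, E z p ↔ z = a ∨ z = b

/-- `p` is the two-tuple `{a, {a, b}}`. -/
def IsTuple (p a b : N) : Prop := ∃ q, IsPair E S q a b ∧ IsPair E S p a q

/-- The tuple of `a` and `b` is an element of `f`. -/
def TupleMem (a b f : N) : Prop := ∃ p, IsTuple E S p a b ∧ E p f

variable {E S}

/-- For the tuple {a, {a, b}} injectivity rests on regularity: the bad case a = {a', b'}, a' = {a,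
b} gives a ∈ a' ∈ a. -/
theorem IsTuple.inj (hE : ∀ x y, E x y → ¬ E y x) {p a b a' b' : N} (h : IsTuple E S p a b)
    (h' : IsTuple E S p a' b') : a = a' ∧ b = b' := by
  obtain ⟨q, ⟨-, hq⟩, -, hp⟩ := h
  obtain ⟨q', ⟨-, hq'⟩, -, hp'⟩ := h'
  have haq : E a q := (hq a).2 (.inl rfl)
  have haq' : E a' q' := (hq' a').2 (.inl rfl)
  have h₁ := (hp' a).1 ((hp a).2 (.inl rfl))
  have h₂ := (hp a').1 ((hp' a').2 (.inl rfl))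
  have haa : a = a' := by
    rcases h₁ with h₁ | rfl
    · exact h₁
    · rcases h₂ with h₂ | rfl
      · exact h₂.symm
      · exact absurd haq (hE _ _ haq')
  subst haa
  have hqq : q = q' := by
    rcases (hp' q).1 ((hp q).2 (.inr rfl)) with rfl | h
    · exact absurd haq (hE _ _ haq)
    · exact h
  subst hqq
  refine ⟨rfl, ?_⟩
  have h₃ := (hq' b).1 ((hq b).2 (.inr rfl))
  have h₄ := (hq b').1 ((hq' b').2 (.inr rfl))
  rcases h₃ with rfl | h₃
  · rcases h₄ with h₄ | h₄ <;> exact h₄.symm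
  · exact h₃

theorem IsTuple.unique (hext : ∀ x y, S x → S y → (∀ z, E z x ↔ E z y) → x = y) {p p' a b : N}
    (h : IsTuple E S p a b) (h' : IsTuple E S p' a b) : p = p' := by
  obtain ⟨q, ⟨hSq, hq⟩, hSp, hp⟩ := h
  obtain ⟨q', ⟨hSq', hq'⟩, hSp', hp'⟩ := h'
  obtain rfl : q = q' := hext _ _ hSq hSq' fun z => (hq z).trans (hq' z).symm
  exact hext _ _ hSp hSp' fun z => (hp z).trans (hp' z).symm

end Tuples

/-! ### Definability of pairs and tuples -/

section Definability

variable {L : FirstOrder.Language.{0, 0}} {M N : Type} [L.Structure M] {r : M → N} {β : Type}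
  {E : N → N → Prop} {S : N → Prop}

theorem dfn_true : Dfn₁ L r fun _ => True :=
  Dfn.false.not.congr fun _ => by simp

theorem dfn_isPair (hr : Function.Surjective r) (hE : Dfn₂ L r E) (hS : Dfn₁ L r S)
    (he : Dfn₂ L r (N := N) (· = ·)) : Dfn₃ L r (IsPair E S) := by
  refine (hS.app hr (.var _)).and (.all hr (.iff ?_ (.or ?_ ?_)))
  · exact hE.app hr (.var _) (.var _)
  · exact he.app hr (.var _) (.var _)
  · exact he.app hr (.var _) (.var _)

theorem dfn_isTuple (hr : Function.Surjective r) (hE : Dfn₂ L r E) (hS : Dfn₁ L r S)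
    (he : Dfn₂ L r (N := N) (· = ·)) : Dfn₃ L r (IsTuple E S) :=
  .ex hr (.and ((dfn_isPair hr hE hS he).app hr (.var _) (.var _) (.var _))
    ((dfn_isPair hr hE hS he).app hr (.var _) (.var _) (.var _)))

theorem dfn_tupleMem (hr : Function.Surjective r) (hE : Dfn₂ L r E) (hS : Dfn₁ L r S)
    (he : Dfn₂ L r (N := N) (· = ·)) : Dfn₃ L r (TupleMem E S) :=
  .ex hr (.and ((dfn_isTuple hr hE hS he).app hr (.var _) (.var _) (.var _))
    (hE.app hr (.var _) (.var _)))

end Definability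

/-! ## Elementary set theory in a model of ZF -/

section ZFModels

variable {M : Type} [LZF.Structure M]

theorem dfn_eq : Dfn₂ LZF (id : M → M) (· = ·) :=
  ⟨(Term.var (Sum.inr 0)).equal (Term.var (Sum.inr 1)), fun w => by simp⟩

theorem dfn_mem : Dfn₂ LZF (id : M → M) Mem :=
  ⟨zmem (Term.var (Sum.inl (Sum.inr 0))) (Term.var (Sum.inl (Sum.inr 1))), fun w => by
    rw [Formula.Realize, realize_zmem]; rfl⟩

/-! ### Absence of membership cycles, and iteration of definable operations -/

namespace ZFModel

theorem exists_insert (h : ZFModel M) (x a : M) : ∃ y, ∀ z, Mem z y ↔ Mem z x ∨ z = a := by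
  obtain ⟨s, hs⟩ := h.pair a a
  obtain ⟨p, hp⟩ := h.pair x s
  obtain ⟨u, hu⟩ := h.union p
  refine ⟨u, fun z => ?_⟩
  simp [hu, hp, hs, or_and_right, exists_or]

theorem not_descending (h : ZFModel M) (x : M) (hx : ∃ y, Mem y x)
    (hd : ∀ y, Mem y x → ∃ z, Mem z y ∧ Mem z x) : False := by
  obtain ⟨y, hy, hm⟩ := h.regularity x hx
  obtain ⟨z, hz, hzx⟩ := hd y hy
  exact hm z hz hzx

/-- The set of the members of the cycle would have no minimal element. Cycles of lengths three and
four are those that a function inside its own graph would create. -/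
theorem not_cycle₄ (h : ZFModel M) {a b c d : M} (h₁ : Mem a b) (h₂ : Mem b c) (h₃ : Mem c d)
    (h₄ : Mem d a) : False := by
  obtain ⟨x, hx⟩ := h.pair a b
  obtain ⟨y, hy⟩ := h.exists_insert x c
  obtain ⟨z, hz⟩ := h.exists_insert y d
  have hz' : ∀ w, Mem w z ↔ ((w = a ∨ w = b) ∨ w = c) ∨ w = d := fun w => by rw [hz, hy, hx]
  refine h.not_descending z ⟨a, by simp [hz']⟩ fun w hw => ?_
  rcases (hz' w).1 hw with ((rfl | rfl) | rfl) | rfl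
  · exact ⟨d, h₄, by simp [hz']⟩
  · exact ⟨a, h₁, by simp [hz']⟩
  · exact ⟨b, h₂, by simp [hz']⟩
  · exact ⟨c, h₃, by simp [hz']⟩

theorem not_cycle₃ (h : ZFModel M) {a b c : M} (h₁ : Mem a b) (h₂ : Mem b c) (h₃ : Mem c a) :
    False := by
  obtain ⟨x, hx⟩ := h.pair a b
  obtain ⟨z, hz⟩ := h.exists_insert x c
  have hz' : ∀ w, Mem w z ↔ (w = a ∨ w = b) ∨ w = c := fun w => by rw [hz, hx]
  refine h.not_descending z ⟨a, by simp [hz']⟩ fun w hw => ?_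
  rcases (hz' w).1 hw with (rfl | rfl) | rfl
  · exact ⟨c, h₃, by simp [hz']⟩
  · exact ⟨a, h₁, by simp [hz']⟩
  · exact ⟨b, h₂, by simp [hz']⟩

theorem mem_asymm (h : ZFModel M) (x y : M) (h₁ : Mem x y) : ¬ Mem y x := fun h₂ =>
  h.not_cycle₄ h₁ h₂ h₁ h₂

theorem exists_tuple (h : ZFModel M) (a b : M) : ∃ p, IsTuple Mem (fun _ => True) p a b := by
  obtain ⟨q, hq⟩ := h.pair a b
  obtain ⟨p, hp⟩ := h.pair a q
  exact ⟨p, q, ⟨trivial, hq⟩, trivial, hp⟩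

/-- `k` is the von Neumann successor of `n`. -/
def IsSucc (k n : M) : Prop := ∀ w, Mem w k ↔ Mem w n ∨ w = n

theorem isSucc_inj (h : ZFModel M) {k m n : M} (hm : IsSucc k m) (hn : IsSucc k n) : m = n := by
  rcases (hn m).1 ((hm m).2 (.inr rfl)) with h₁ | h₁
  · rcases (hm n).1 ((hn n).2 (.inr rfl)) with h₂ | h₂
    · exact absurd h₂ (h.mem_asymm _ _ h₁)
    · exact h₂.symm
  · exact h₁

/-- Every pair `(k, y)` in `s` is `(0, z)` or arises from a pair `(n, x)` in `s` as
`(n + 1, σ x)`. -/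
def IsJustified (z : M) (σ : M → M) (s : M) : Prop :=
  ∀ k y, TupleMem Mem (fun _ => True) k y s → ((∀ w, ¬ Mem w k) ∧ y = z) ∨
    ∃ n x, TupleMem Mem (fun _ => True) n x s ∧ IsSucc k n ∧ y = σ x

/-- `x` is the `n`-th iterate of `σ` at `z`. -/
def IsIterate (z : M) (σ : M → M) (n x : M) : Prop :=
  ∃ s, TupleMem Mem (fun _ => True) n x s ∧ IsJustified z σ s

theorem dfn_isIterate (z : M) {σ : M → M} (hσ : Dfn₂ LZF id fun x y => y = σ x) :
    Dfn₂ LZF id (IsIterate z σ) := by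
  have hr : Function.Surjective (id : M → M) := Function.surjective_id
  have ht := dfn_tupleMem hr dfn_mem dfn_true dfn_eq
  have hs : Dfn₂ LZF (id : M → M) IsSucc := .all hr (.iff (dfn_mem.app hr (.var _) (.var _))
    (.or (dfn_mem.app hr (.var _) (.var _)) (dfn_eq.app hr (.var _) (.var _))))
  have hj : Dfn₁ LZF id (IsJustified z σ) := by
    refine .all hr (.all hr (.imp (ht.app hr (.var _) (.var _) (.var _)) (.or (.and
      (.all hr (.not (dfn_mem.app hr (.var _) (.var _)))) (dfn_eq.app hr (.var _) (.const _)))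
      (.ex hr (.ex hr (.and (ht.app hr (.var _) (.var _) (.var _))
        (.and (hs.app hr (.var _) (.var _)) (hσ.app hr (.var _) (.var _)))))))))
  exact .ex hr (.and (ht.app hr (.var _) (.var _) (.var _)) (hj.app hr (.var _)))

theorem isIterate_zero (h : ZFModel M) {z : M} {σ : M → M} {e : M} (he : ∀ w, ¬ Mem w e) :
    IsIterate z σ e z := by
  obtain ⟨p, hp⟩ := h.exists_tuple e z
  obtain ⟨s, hs⟩ := h.pair p p
  refine ⟨s, ⟨p, hp, by simp [hs]⟩, fun k y ⟨q, hq, hqs⟩ => ?_⟩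
  obtain rfl : q = p := by simpa [hs] using hqs
  obtain ⟨rfl, rfl⟩ := hp.inj h.mem_asymm hq
  exact .inl ⟨he, rfl⟩

/-- Adding the pair (k, σ x) to a witness for (n, x) keeps every pair justified. -/
theorem isIterate_succ (h : ZFModel M) {z : M} {σ : M → M} {k n x : M} (hk : IsSucc k n)
    (hx : IsIterate z σ n x) : IsIterate z σ k (σ x) := by
  obtain ⟨s, hnx, hj⟩ := hx
  obtain ⟨p, hp⟩ := h.exists_tuple k (σ x)
  obtain ⟨s', hs'⟩ := h.exists_insert s p
  have hle : ∀ a b, TupleMem Mem (fun _ => True) a b s → TupleMem Mem (fun _ => True) a b s' :=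
    fun a b ⟨q, hq, hqs⟩ => ⟨q, hq, (hs' q).2 (.inl hqs)⟩
  refine ⟨s', ⟨p, hp, (hs' p).2 (.inr rfl)⟩, fun k' y ⟨q, hq, hqs⟩ => ?_⟩
  rcases (hs' q).1 hqs with hqs | rfl
  · exact (hj k' y ⟨q, hq, hqs⟩).imp_right fun ⟨n, x, hn, hr⟩ => ⟨n, x, hle _ _ hn, hr⟩
  · obtain ⟨rfl, rfl⟩ := hp.inj h.mem_asymm hq
    exact .inr ⟨n, x, hle _ _ hnx, hk, rfl⟩

theorem eq_of_isIterate_zero {z : M} {σ : M → M} {e x : M} (he : ∀ w, ¬ Mem w e)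
    (hx : IsIterate z σ e x) : x = z := by
  obtain ⟨s, hs, hj⟩ := hx
  rcases hj _ _ hs with h₁ | ⟨n, x, -, hn, -⟩
  · exact h₁.2
  · exact absurd ((hn n).2 (.inr rfl)) (he n)

/-- The pair at `k` can only be justified by a pair at its unique predecessor `n`, and the same
witness serves there. -/
theorem exists_of_isIterate_succ (h : ZFModel M) {z : M} {σ : M → M} {k n y : M}
    (hk : IsSucc k n) (hy : IsIterate z σ k y) : ∃ x, IsIterate z σ n x ∧ y = σ x := by
  obtain ⟨s, hs, hj⟩ := hy
  rcases hj _ _ hs with h₁ | ⟨n', x, hx, hn, rfl⟩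
  · exact absurd ((hk n).2 (.inr rfl)) (h₁.1 n)
  · obtain rfl := h.isSucc_inj hk hn
    exact ⟨x, ⟨s, hx, hj⟩, rfl⟩

/-- The orbit of `z` under a definable operation `σ` is a set. -/
theorem exists_orbit (h : ZFModel M) (z : M) {σ : M → M} (hσ : Dfn₂ LZF id fun x y => y = σ x) :
    ∃ W, Mem z W ∧ (∀ x, Mem x W → Mem (σ x) W) ∧
      ∀ x, Mem x W → x = z ∨ ∃ y, Mem y W ∧ x = σ y := by
  have hr : Function.Surjective (id : M → M) := Function.surjective_id
  have hR := dfn_isIterate z hσ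
  obtain ⟨I, ⟨e, he, heI⟩, hI⟩ := h.infinity
  -- `I'` consists of the indices with exactly one iterate. It contains zero, and successors in `I`
  -- of its elements lie in it again, so the set `W₀` of the iterates contains `z` and is closed
  -- under `σ`; no induction over `I` is needed.
  obtain ⟨I', hI'⟩ := h.separation (fun n => ∃ x, IsIterate z σ n x ∧
    ∀ x', IsIterate z σ n x' → x' = x)
    (.ex hr (.and (hR.app hr (.var _) (.var _)) (.all hr (.imp (hR.app hr (.var _) (.var _))
      (dfn_eq.app hr (.var _) (.var _)))))) I
  obtain ⟨W₀, hW₀⟩ := h.replacement _ hR I' fun n hn => ((hI' n).1 hn).2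
  have hz : Mem z W₀ := (hW₀ z).2 ⟨e, (hI' e).2 ⟨heI, z, h.isIterate_zero he,
    fun x' hx' => eq_of_isIterate_zero he hx'⟩, h.isIterate_zero he⟩
  have hs : ∀ x, Mem x W₀ → Mem (σ x) W₀ := by
    intro x hx
    obtain ⟨n, hn, hnx⟩ := (hW₀ x).1 hx
    obtain ⟨hnI, x', -, hu⟩ := (hI' n).1 hn
    obtain ⟨k, hkI, hk⟩ := hI n hnI
    refine (hW₀ _).2 ⟨k, (hI' k).2 ⟨hkI, σ x, h.isIterate_succ hk hnx, fun y hy => ?_⟩,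
      h.isIterate_succ hk hnx⟩
    obtain ⟨x'', hx'', rfl⟩ := h.exists_of_isIterate_succ hk hy
    rw [hu _ hx'', hu _ hnx]
  -- `I` may have superfluous elements, so `W₀` is cut down to its smallest closed part. The
  -- operation enters through its graph because definability is set up for relations.
  obtain ⟨W, hW⟩ := h.separation (fun x => ∀ J, Mem z J → (∀ u, Mem u J → ∀ v, v = σ u → Mem v J) →
      Mem x J)
    (.all hr (.imp (dfn_mem.app hr (.const _) (.var _)) (.imp
      (.all hr (.imp (dfn_mem.app hr (.var _) (.var _)) (.all hr (.imp
        (hσ.app hr (.var _) (.var _)) (dfn_mem.app hr (.var _) (.var _))))))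
      (dfn_mem.app hr (.var _) (.var _))))) W₀
  have hzW : Mem z W := (hW z).2 ⟨hz, fun J hJ _ => hJ⟩
  have hsW : ∀ x, Mem x W → Mem (σ x) W := fun x hx => (hW _).2
    ⟨hs x ((hW x).1 hx).1, fun J hJ hc => hc x (((hW x).1 hx).2 J hJ hc) _ rfl⟩
  refine ⟨W, hzW, hsW, fun x hx => ?_⟩
  -- `J` again contains `z` and is closed under `σ`, so by minimality it is all of `W`.
  obtain ⟨J, hJ⟩ := h.separation (fun x => x = z ∨ ∃ y, Mem y W ∧ x = σ y)
    (.or (dfn_eq.app hr (.var _) (.const _)) (.ex hr (.and (dfn_mem.app hr (.var _) (.const _))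
      (hσ.app hr (.var _) (.var _))))) W
  exact ((hJ x).1 (((hW x).1 hx).2 J ((hJ z).2 ⟨hzW, .inl rfl⟩) (by
    rintro u hu _ rfl
    exact (hJ _).2 ⟨hsW u ((hJ u).1 hu).1, .inr ⟨u, ((hJ u).1 hu).1, rfl⟩⟩))).2

end ZFModel
end ZFModels

/-! ## Universes of sets and non-sets with codes -/

section Universes

/-- `y` is the singleton of `x`. -/
def IsSing {N : Type} (E : N → N → Prop) (S : N → Prop) (y x : N) : Prop :=
  S y ∧ ∀ w, E w y ↔ w = x

/-- A universe of sets and non-sets, definable over `M` along `r`, that satisfies the axioms of set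
theory and in which every set `F` has a code, that is, a non-set `f` with `C f F`. -/
structure CodedUniverse (L : FirstOrder.Language.{0, 0}) {M N : Type} [L.Structure M] (r : M → N)
    (E : N → N → Prop) (S : N → Prop) (C : N → N → Prop) : Prop where
  surj : Function.Surjective r
  dfn_mem : Dfn₂ L r E
  dfn_isSet : Dfn₁ L r S
  dfn_code : Dfn₂ L r C
  dfn_eq : Dfn₂ L r (N := N) (· = ·)
  isSet_of_mem : ∀ a x, E a x → S x
  ext : ∀ x y, S x → S y → (∀ z, E z x ↔ E z y) → x = y
  empty : ∃ x, S x ∧ ∀ y, ¬ E y x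
  pair : ∀ x y, ∃ z, S z ∧ ∀ w, E w z ↔ w = x ∨ w = y
  union : ∀ x, S x → ∃ y, S y ∧ ∀ z, E z y ↔ ∃ w, E w x ∧ E z w
  power : ∀ x, S x → ∃ y, S y ∧ ∀ z, E z y ↔ S z ∧ ∀ w, E w z → E w x
  regularity : ∀ x, (∃ y, E y x) → ∃ y, E y x ∧ ∀ z, E z y → ¬ E z x
  infinity : ∃ W, S W ∧ (∀ x, S x → (∀ y, ¬ E y x) → E x W) ∧
    (∀ x y, E x W → IsSing E S y x → E y W) ∧
    ∀ x, E x W → (S x ∧ ∀ y, ¬ E y x) ∨ ∃ y, E y W ∧ IsSing E S x y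
  separation : ∀ P : N → Prop, Dfn₁ L r P → ∀ x, S x → ∃ y, S y ∧ ∀ z, E z y ↔ E z x ∧ P z
  replacement : ∀ R : N → N → Prop, Dfn₂ L r R → ∀ x, S x →
    (∀ y, E y x → ∃ z, R y z ∧ ∀ z', R y z' → z' = z) →
      ∃ z, S z ∧ ∀ w, E w z ↔ ∃ y, E y x ∧ R y w
  isSet_of_code : ∀ f F, C f F → S F
  not_isSet_of_code : ∀ f F, C f F → ¬ S f
  code_unique : ∀ f F F', C f F → C f F' → F = F'
  exists_code : ∀ F, S F → ∃ f, C f F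
  -- In a tuple p = {a, q} with q = {a, b}, the component a lies two memberships below F and b lies
  -- three below. These two conditions keep a code out of both positions.
  code_not_mem₂ : ∀ f F p, C f F → E p F → ¬ E f p
  code_not_mem₃ : ∀ f F p q, C f F → E p F → E q p → ¬ E f q

/-! ### The things of a model of ZF -/

variable {M : Type}

/-- The things interpreted in a model of set theory: everything but the empty set `o`. -/
abbrev Thing (o : M) : Type := {x : M // x ≠ o}

namespace Thing

variable {o : M}

open Classical in
/-- The retraction of the model onto the things that maps `o` to `d`. -/
noncomputable def retract (d : Thing o) (x : M) : Thing o := if hx : x = o then d else ⟨x, hx⟩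

theorem retract_of_ne (d : Thing o) {x : M} (hx : x ≠ o) : retract d x = ⟨x, hx⟩ := dif_neg hx

@[simp] theorem retract_val (d x : Thing o) : retract d x.1 = x := retract_of_ne d x.2

theorem retract_surjective (d : Thing o) : Function.Surjective (retract d) :=
  fun x => ⟨x.1, retract_val d x⟩

variable [LZF.Structure M]

/-- The sets among the things are those that contain `o`. -/
def IsSet (x : Thing o) : Prop := Mem o x.1

/-- Membership among things disregards `o`. -/
def Elem (y x : Thing o) : Prop := Mem o x.1 ∧ Mem y.1 x.1

/-- The thing `{F}` is the code of `F`. -/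
def Code (f F : Thing o) : Prop := IsSet F ∧ ∀ z, Mem z f.1 ↔ z = F.1

theorem dfn_retract (d : Thing o) : Dfn₂ LZF id fun x y : M => (retract d x).1 = y := by
  have hr : Function.Surjective (id : M → M) := Function.surjective_id
  refine ((dfn_eq.app hr (.var 0) (.const o)).and (dfn_eq.app hr (.var 1) (.const d.1))).or
    ((dfn_eq.app hr (.var 0) (.const o)).not.and (dfn_eq.app hr (.var 1) (.var 0))) |>.congr
    fun w => ?_
  by_cases hx : w 0 = o
  · simp [retract, hx, eq_comm]
  · simp [retract, hx, eq_comm]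

/-- The retraction has a definable graph, so it can be eliminated by quantifying over its value. -/
theorem dfn_val₁ (d : Thing o) {P : M → Prop} (hP : Dfn₁ LZF id P) :
    Dfn₁ LZF (retract d) fun x => P x.1 := by
  have hr : Function.Surjective (id : M → M) := Function.surjective_id
  have : Dfn₁ LZF id fun x : M => ∃ y, (retract d x).1 = y ∧ P y :=
    .ex hr (.and ((dfn_retract d).app hr (.var _) (.var _)) (hP.app hr (.var _)))
  exact (this.congr fun w => by simp : Dfn₁ LZF id fun x : M => P (retract d x).1)

theorem dfn_val₂ (d : Thing o) {P : M → M → Prop} (hP : Dfn₂ LZF id P) :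
    Dfn₂ LZF (retract d) fun x y => P x.1 y.1 := by
  have hr : Function.Surjective (id : M → M) := Function.surjective_id
  have : Dfn₂ LZF id fun x x' : M =>
      ∃ y, (retract d x).1 = y ∧ ∃ y', (retract d x').1 = y' ∧ P y y' :=
    .ex hr (.and ((dfn_retract d).app hr (.var _) (.var _)) (.ex hr (.and
      ((dfn_retract d).app hr (.var _) (.var _)) (hP.app hr (.var _) (.var _)))))
  exact (this.congr fun w => by simp :
    Dfn₂ LZF id fun x x' : M => P (retract d x).1 (retract d x').1)

/-- Adjoin the marker `o` to `y`; the result contains `o` and hence differs from it by regularity.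
-/
theorem exists_set (h : ZFModel M) (y : M) :
    ∃ x : Thing o, IsSet x ∧ ∀ z : Thing o, Elem z x ↔ Mem z.1 y := by
  obtain ⟨x, hx⟩ := h.exists_insert y o
  have hox : Mem o x := (hx o).2 (.inr rfl)
  refine ⟨⟨x, fun he => ?_⟩, hox, fun z => ?_⟩
  · rw [he] at hox
    exact h.mem_asymm _ _ hox hox
  · simp [Elem, hox, hx, z.2]

theorem codedUniverse (h : ZFModel M) (ho : ∀ y, ¬ Mem y o) (d : Thing o) :
    CodedUniverse LZF (retract d) (Elem (o := o)) IsSet Code := by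
  have hr : Function.Surjective (id : M → M) := Function.surjective_id
  have hne : ∀ {a b : M}, Mem a b → b ≠ o := fun {a b} hab hb => ho a (hb ▸ hab)
  constructor
  case surj => exact retract_surjective d
  case dfn_mem =>
    exact dfn_val₂ d (P := fun a b => Mem o b ∧ Mem a b)
      (.and (dfn_mem.app hr (.const _) (.var _)) (dfn_mem.app hr (.var _) (.var _)))
  case dfn_isSet => exact dfn_val₁ d (P := fun a => Mem o a) (dfn_mem.app hr (.const _) (.var _))
  case dfn_code =>
    exact dfn_val₂ d (P := fun f F => Mem o F ∧ ∀ z, Mem z f ↔ z = F)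
      (.and (dfn_mem.app hr (.const _) (.var _)) (.all hr (.iff (dfn_mem.app hr (.var _) (.var _))
        (dfn_eq.app hr (.var _) (.var _)))))
  case dfn_eq => exact (dfn_val₂ d dfn_eq).congr fun w => Subtype.ext_iff.symm
  case isSet_of_mem => exact fun a x hx => hx.1
  case ext =>
    refine fun x y hx hy hz => Subtype.ext (h.ext _ _ fun z => ?_)
    by_cases hzo : z = o
    · subst hzo
      exact iff_of_true hx hy
    · have := hz ⟨z, hzo⟩
      simpa [Elem, show Mem o x.1 from hx, show Mem o y.1 from hy] using this
  case empty =>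
    obtain ⟨x, hx, hE⟩ := exists_set (o := o) h o
    exact ⟨x, hx, fun y => by simp [hE, ho]⟩
  case pair =>
    intro x y
    obtain ⟨p, hp⟩ := h.pair x.1 y.1
    obtain ⟨z, hz, hE⟩ := exists_set (o := o) h p
    exact ⟨z, hz, fun w => by simp [hE, hp, Subtype.ext_iff]⟩
  case union =>
    intro x hx
    -- Members of `x` that are non-sets must not contribute: they have members in the model but no
    -- elements as things.
    obtain ⟨s, hs⟩ := h.separation (fun w => Mem o w) (dfn_mem.app hr (.const _) (.var _)) x.1
    obtain ⟨u, hu⟩ := h.union s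
    obtain ⟨y, hy, hE⟩ := exists_set (o := o) h u
    refine ⟨y, hy, fun z => ?_⟩
    rw [hE, hu]
    constructor
    · rintro ⟨w, hw, hzw⟩
      exact ⟨⟨w, hne hzw⟩, ⟨hx, ((hs w).1 hw).1⟩, ((hs w).1 hw).2, hzw⟩
    · rintro ⟨w, hw, hzw⟩
      exact ⟨w.1, (hs _).2 ⟨hw.2, hzw.1⟩, hzw.2⟩
  case power =>
    intro x hx
    obtain ⟨p, hp⟩ := h.power x.1
    obtain ⟨s, hs⟩ := h.separation (fun w => Mem o w) (dfn_mem.app hr (.const _) (.var _)) p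
    obtain ⟨y, hy, hE⟩ := exists_set (o := o) h s
    refine ⟨y, hy, fun z => ?_⟩
    rw [hE, hs, hp, and_comm]
    refine and_congr_right fun hz => ⟨fun hs w hw => ⟨hx, hs _ hw.2⟩, fun hs w hw => ?_⟩
    by_cases hwo : w = o
    · exact hwo ▸ hx
    · exact (hs ⟨w, hwo⟩ ⟨hz, hw⟩).2
  case regularity =>
    rintro x ⟨y, hy⟩
    -- The marker is removed first, since otherwise regularity might return `o` itself.
    obtain ⟨s, hs⟩ := h.separation (fun w => w ≠ o) (dfn_eq.app hr (.var _) (.const _)).not x.1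
    obtain ⟨m, hm, hmin⟩ := h.regularity s ⟨y.1, (hs _).2 ⟨hy.2, y.2⟩⟩
    refine ⟨⟨m, ((hs m).1 hm).2⟩, ⟨hy.1, ((hs m).1 hm).1⟩, fun z hz hzx => ?_⟩
    exact hmin z.1 hz.2 ((hs _).2 ⟨hzx.2, z.2⟩)
  case infinity =>
    -- As things, `e` = {o} is the empty set and `σ x` = {x, o} is the singleton of x, so the orbit
    -- of `e` under `σ` serves as ω.
    obtain ⟨e, he⟩ := h.pair o o
    choose σ hσ using fun x : M => h.pair x o
    have hd : Dfn₂ LZF id fun x y : M => y = σ x := by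
      refine Dfn.congr (P := fun w : Fin 2 → M => ∀ z, Mem z (w 1) ↔ z = w 0 ∨ z = o)
        (.all hr (.iff (dfn_mem.app hr (.var _) (.var _)) (.or (dfn_eq.app hr (.var _) (.var _))
          (dfn_eq.app hr (.var _) (.const _))))) fun w => ⟨fun hw => ?_, fun hw z => ?_⟩
      · exact h.ext _ _ fun z => (hw z).trans (hσ _ z).symm
      · rw [hw, hσ]
    obtain ⟨V, hV₀, hV₁, hV₂⟩ := h.exists_orbit e hd
    obtain ⟨W, hW, hE⟩ := exists_set (o := o) h V
    have hoe : Mem o e := (he o).2 (.inl rfl)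
    have hoσ : ∀ x, Mem o (σ x) := fun x => (hσ x o).2 (.inr rfl)
    have hsing : ∀ x y : Thing o, IsSing Elem IsSet y x ↔ y.1 = σ x.1 := by
      refine fun x y => ⟨fun hy => h.ext _ _ fun z => ?_, fun hy => ⟨?_, fun w => ?_⟩⟩
      · rw [hσ]
        by_cases hz : z = o
        · subst hz
          exact iff_of_true hy.1 (.inr rfl)
        · have := hy.2 ⟨z, hz⟩
          simpa [Elem, show Mem o y.1 from hy.1, hz, Subtype.ext_iff] using this
      · rw [IsSet, hy]
        exact hoσ _
      · rw [Elem, hy, hσ, hσ, Subtype.ext_iff]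
        simp [w.2]
    refine ⟨W, hW, fun x hx hxe => ?_, fun x y hx hy => ?_, fun x hx => ?_⟩
    · have : x.1 = e := by
        refine h.ext _ _ fun z => ?_
        rw [he, or_self]
        by_cases hz : z = o
        · subst hz
          exact iff_of_true hx rfl
        · exact iff_of_false (fun hzx => hxe ⟨z, hz⟩ ⟨hx, hzx⟩) hz
      rw [hE, this]
      exact hV₀
    · rw [hE, (hsing x y).1 hy]
      exact hV₁ _ ((hE x).1 hx)
    · rcases hV₂ _ ((hE x).1 hx) with hxe | ⟨y, hy, hxy⟩
      · refine .inl ⟨by rw [IsSet, hxe]; exact hoe, fun y hy => y.2 ?_⟩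
        have := hy.2
        rw [hxe, he, or_self] at this
        exact this
      · have hyo : y ≠ o := by
          rcases hV₂ y hy with rfl | ⟨u, -, rfl⟩
          · exact hne hoe
          · exact hne (hoσ u)
        exact .inr ⟨⟨y, hyo⟩, (hE _).2 hy, (hsing ⟨y, hyo⟩ x).2 hxy⟩
  case separation =>
    intro P hP x hx
    obtain ⟨s, hs⟩ := h.separation (fun z => P (retract d z)) hP x.1
    obtain ⟨y, hy, hE⟩ := exists_set (o := o) h s
    refine ⟨y, hy, fun z => ?_⟩
    rw [hE, hs, retract_val]
    exact and_congr_left fun _ => ⟨fun hz => ⟨hx, hz⟩, fun hz => hz.2⟩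
  case replacement =>
    intro R hR x hx hu
    obtain ⟨s, hs⟩ := h.separation (fun w => w ≠ o) (dfn_eq.app hr (.var _) (.const _)).not x.1
    -- The retraction identifies `o` with `d`; requiring `b ≠ o` restores uniqueness of the value.
    obtain ⟨t, ht⟩ := h.replacement (fun a b => R (retract d a) (retract d b) ∧ b ≠ o)
      (.and hR (dfn_eq.app hr (.var _) (.const _)).not) s (fun y hy => by
        obtain ⟨hyx, hyo⟩ := (hs y).1 hy
        obtain ⟨z, hz, hz'⟩ := hu ⟨y, hyo⟩ ⟨hx, hyx⟩
        refine ⟨z.1, ⟨by rwa [retract_val, retract_of_ne d hyo], z.2⟩, fun z' hR' => ?_⟩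
        obtain ⟨hR', hzo⟩ := hR'
        rw [retract_of_ne d hyo, retract_of_ne d hzo] at hR'
        exact Subtype.ext_iff.1 (hz' _ hR'))
    obtain ⟨y, hy, hE⟩ := exists_set (o := o) h t
    refine ⟨y, hy, fun z => ?_⟩
    rw [hE, ht]
    constructor
    · rintro ⟨w, hw, hR', -⟩
      obtain ⟨hwx, hwo⟩ := (hs w).1 hw
      rw [retract_val, retract_of_ne d hwo] at hR'
      exact ⟨_, ⟨hx, hwx⟩, hR'⟩
    · rintro ⟨w, hw, hR'⟩
      exact ⟨w.1, (hs _).2 ⟨hw.2, w.2⟩, by simpa using hR', z.2⟩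
  case isSet_of_code => exact fun f F hf => hf.1
  case not_isSet_of_code =>
    intro f F hf hS
    exact F.2 ((hf.2 o).1 hS).symm
  case code_unique =>
    intro f F F' hF hF'
    exact Subtype.ext ((hF'.2 _).1 ((hF.2 _).2 rfl))
  case exists_code =>
    intro F hF
    -- The code is {F}. It is a non-set because its only member F is not `o`.
    obtain ⟨f, hf⟩ := h.pair F.1 F.1
    exact ⟨⟨f, hne ((hf F.1).2 (.inl rfl))⟩, hF, by simpa using hf⟩
  case code_not_mem₂ =>
    intro f F p hf hp hfp
    exact h.not_cycle₃ hfp.2 hp.2 ((hf.2 _).2 rfl)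
  case code_not_mem₃ =>
    intro f F p q hf hp hq hfq
    exact h.not_cycle₄ hfq.2 hq.2 hp.2 ((hf.2 _).2 rfl)

end Thing
end Universes

/-! ## Models of the theory of sets and functions -/

section TModels

variable {N : Type} [LT.Structure N]

/-- `x` is a set. -/
def TSet (x : N) : Prop := Structure.RelMap (L := LT) (n := 1) TRel.isSet ![x]

/-- `f` is a function on `x`. -/
def TFun (f x : N) : Prop := Structure.RelMap (L := LT) (n := 2) TRel.isFun ![f, x]

/-- `a` is an element of `b`. -/
def TMem (a b : N) : Prop := Structure.RelMap (L := LT) (n := 2) TRel.mem ![a, b]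

/-- `f : a ↠ b` -/
def TOnto (f a b : N) : Prop := Structure.RelMap (L := LT) (n := 3) TRel.onto ![f, a, b]

/-- `f : a ↦ b` -/
def TMaps (f a b : N) : Prop := Structure.RelMap (L := LT) (n := 3) TRel.maps ![f, a, b]

variable (N) in
/-- The value of `∅`. -/
def tEmp : N := Structure.funMap (L := LT) (n := 0) TFunc.empty ![]

variable (N) in
/-- The value of `ω`. -/
def tOmg : N := Structure.funMap (L := LT) (n := 0) TFunc.omega ![]

variable (N) in
/-- The value of `1_∅`. -/
def tOne : N := Structure.funMap (L := LT) (n := 0) TFunc.inactive ![]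

/-- The value of `x⁺`. -/
def tPlus (x : N) : N := Structure.funMap (L := LT) (n := 1) TFunc.plus ![x]

variable {α : Type} {n : ℕ} (v : α → N) (xs : Fin n → N)

@[simp] theorem realize_emp : (emp : LT.Term (α ⊕ Fin n)).realize (Sum.elim v xs) = tEmp N :=
  congrArg (Structure.funMap (L := LT) (n := 0) TFunc.empty) (Subsingleton.elim _ _)

@[simp] theorem realize_omg : (omg : LT.Term (α ⊕ Fin n)).realize (Sum.elim v xs) = tOmg N :=
  congrArg (Structure.funMap (L := LT) (n := 0) TFunc.omega) (Subsingleton.elim _ _)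

@[simp] theorem realize_one : (one : LT.Term (α ⊕ Fin n)).realize (Sum.elim v xs) = tOne N :=
  congrArg (Structure.funMap (L := LT) (n := 0) TFunc.inactive) (Subsingleton.elim _ _)

@[simp] theorem realize_plus (t : LT.Term (α ⊕ Fin n)) :
    (plus t).realize (Sum.elim v xs) = tPlus (t.realize (Sum.elim v xs)) :=
  congrArg _ (funext fun i => by fin_cases i; rfl)

@[simp] theorem realize_isSet (t : LT.Term (α ⊕ Fin n)) :
    (isSet t).Realize v xs ↔ TSet (t.realize (Sum.elim v xs)) :=
  iff_of_eq (congrArg (Structure.RelMap (L := LT) (n := 1) TRel.isSet)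
    (funext fun i => by fin_cases i; rfl))

@[simp] theorem realize_isFun (s t : LT.Term (α ⊕ Fin n)) : (isFun s t).Realize v xs ↔
    TFun (s.realize (Sum.elim v xs)) (t.realize (Sum.elim v xs)) :=
  iff_of_eq (congrArg (Structure.RelMap (L := LT) (n := 2) TRel.isFun)
    (funext fun i => by fin_cases i <;> rfl))

@[simp] theorem realize_tmem (s t : LT.Term (α ⊕ Fin n)) : (tmem s t).Realize v xs ↔
    TMem (s.realize (Sum.elim v xs)) (t.realize (Sum.elim v xs)) :=
  iff_of_eq (congrArg (Structure.RelMap (L := LT) (n := 2) TRel.mem)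
    (funext fun i => by fin_cases i <;> rfl))

@[simp] theorem realize_onto (f s t : LT.Term (α ⊕ Fin n)) : (onto f s t).Realize v xs ↔
    TOnto (f.realize (Sum.elim v xs)) (s.realize (Sum.elim v xs)) (t.realize (Sum.elim v xs)) :=
  iff_of_eq (congrArg (Structure.RelMap (L := LT) (n := 3) TRel.onto)
    (funext fun i => by fin_cases i <;> rfl))

@[simp] theorem realize_maps (f s t : LT.Term (α ⊕ Fin n)) : (maps f s t).Realize v xs ↔
    TMaps (f.realize (Sum.elim v xs)) (s.realize (Sum.elim v xs)) (t.realize (Sum.elim v xs)) :=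
  iff_of_eq (congrArg (Structure.RelMap (L := LT) (n := 3) TRel.maps)
    (funext fun i => by fin_cases i <;> rfl))

@[simp] theorem realize_up (t : LT.Term (α ⊕ Fin n)) (a : N) :
    (up t).realize (Sum.elim v (Fin.snoc xs a)) = t.realize (Sum.elim v xs) := by
  rw [up, Term.realize_relabel]
  congr 1
  funext x
  rcases x with x | x <;> simp

@[simp] theorem realize_new (a : N) :
    (new : LT.Term (α ⊕ Fin (n + 1))).realize (Sum.elim v (Fin.snoc xs a)) = a := by
  simp [new]

@[simp] theorem realize_allSet (φ : LT.BoundedFormula α (n + 1)) : (allSet φ).Realize v xs ↔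
    ∀ x : N, TSet x → φ.Realize v (Fin.snoc xs x) := by
  simp only [allSet, BoundedFormula.realize_all, BoundedFormula.realize_imp, realize_isSet,
    realize_new]

@[simp] theorem realize_exSet (φ : LT.BoundedFormula α (n + 1)) : (exSet φ).Realize v xs ↔
    ∃ x : N, TSet x ∧ φ.Realize v (Fin.snoc xs x) := by
  simp only [exSet, BoundedFormula.realize_ex, BoundedFormula.realize_inf, realize_isSet,
    realize_new]

@[simp] theorem realize_allFun (t : LT.Term (α ⊕ Fin n)) (φ : LT.BoundedFormula α (n + 1)) :
    (allFun t φ).Realize v xs ↔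
      ∀ f : N, TFun f (t.realize (Sum.elim v xs)) → φ.Realize v (Fin.snoc xs f) := by
  simp only [allFun, BoundedFormula.realize_all, BoundedFormula.realize_imp, realize_isFun,
    realize_new, realize_up]

@[simp] theorem realize_exFun (t : LT.Term (α ⊕ Fin n)) (φ : LT.BoundedFormula α (n + 1)) :
    (exFun t φ).Realize v xs ↔
      ∃ f : N, TFun f (t.realize (Sum.elim v xs)) ∧ φ.Realize v (Fin.snoc xs f) := by
  simp only [exFun, BoundedFormula.realize_ex, BoundedFormula.realize_inf, realize_isFun,
    realize_new, realize_up]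

@[simp] theorem realize_allIn (t : LT.Term (α ⊕ Fin n)) (φ : LT.BoundedFormula α (n + 1)) :
    (allIn t φ).Realize v xs ↔
      ∀ x : N, TMem x (t.realize (Sum.elim v xs)) → φ.Realize v (Fin.snoc xs x) := by
  simp only [allIn, BoundedFormula.realize_all, BoundedFormula.realize_imp, realize_tmem,
    realize_new, realize_up]

@[simp] theorem realize_exIn (t : LT.Term (α ⊕ Fin n)) (φ : LT.BoundedFormula α (n + 1)) :
    (exIn t φ).Realize v xs ↔
      ∃ x : N, TMem x (t.realize (Sum.elim v xs)) ∧ φ.Realize v (Fin.snoc xs x) := by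
  simp only [exIn, BoundedFormula.realize_ex, BoundedFormula.realize_inf, realize_tmem,
    realize_new, realize_up]

@[simp] theorem realize_tupleMem (a b f : LT.Term (α ⊕ Fin n)) : (tupleMem a b f).Realize v xs ↔
    TupleMem TMem TSet (a.realize (Sum.elim v xs)) (b.realize (Sum.elim v xs))
      (f.realize (Sum.elim v xs)) := by
  simp only [tupleMem, isTuple, isPair, TupleMem, IsTuple, IsPair, BoundedFormula.realize_ex,
    BoundedFormula.realize_inf, BoundedFormula.realize_all, BoundedFormula.realize_iff,
    BoundedFormula.realize_sup, BoundedFormula.realize_bdEqual, realize_tmem, realize_isSet,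
    realize_new, realize_up]

@[simp] theorem realize_isTuple (p a b : LT.Term (α ⊕ Fin n)) : (isTuple p a b).Realize v xs ↔
    IsTuple TMem TSet (p.realize (Sum.elim v xs)) (a.realize (Sum.elim v xs))
      (b.realize (Sum.elim v xs)) := by
  simp only [isTuple, isPair, IsTuple, IsPair, BoundedFormula.realize_ex,
    BoundedFormula.realize_inf, BoundedFormula.realize_all, BoundedFormula.realize_iff,
    BoundedFormula.realize_sup, BoundedFormula.realize_bdEqual, realize_tmem, realize_isSet,
    realize_new, realize_up]

/-- `f` is the graph of a function from `x` to `y`. -/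
def IsGraph (f x y : N) : Prop :=
  (∀ p, TMem p f → ∃ a, TMem a x ∧ ∃ b, TMem b y ∧ IsTuple TMem TSet p a b) ∧
    ∀ a, TMem a x → ∃ b, TupleMem TMem TSet a b f ∧ ∀ b', TupleMem TMem TSet a b' f → b' = b

@[simp] theorem realize_isGraph (f s t : LT.Term (α ⊕ Fin n)) : (isGraph f s t).Realize v xs ↔
    IsGraph (f.realize (Sum.elim v xs)) (s.realize (Sum.elim v xs))
      (t.realize (Sum.elim v xs)) := by
  simp only [isGraph, IsGraph, BoundedFormula.realize_inf, realize_allIn, realize_exIn,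
    BoundedFormula.realize_ex, BoundedFormula.realize_all, BoundedFormula.realize_imp,
    BoundedFormula.realize_bdEqual, realize_isTuple, realize_tupleMem, realize_new, realize_up]

variable (N) in
/-- The content of the axioms of the theory of sets and functions in a model. -/
structure TModel : Prop where
  sortThing : ∀ x : N, TSet x ∨ ∃ y : N, TSet y ∧ TFun x y
  sortFun : ∀ f x : N, TFun f x → TSet x
  sortNonempty : ∀ x : N, TSet x → ∃ f : N, TFun f x
  ext : ∀ x : N, TSet x → ∀ y : N, TSet y → (x = y ↔ ∀ z, TMem z x ↔ TMem z y)
  funNotSet : ∀ x : N, TSet x → ∀ f : N, TFun f x → ∀ y : N, TSet y → f ≠ y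
  setNotFun : ∀ x : N, TSet x → ∀ a b : N, ¬ TOnto x a b ∧ ¬ TMaps x a b
  empty : TSet (tEmp N) ∧ ∀ x, ¬ TMem x (tEmp N)
  pair : ∀ a b : N, ∃ x, TSet x ∧ ∀ z, TMem z x ↔ z = a ∨ z = b
  union : ∀ x : N, TSet x → ∃ y, TSet y ∧ ∀ a, TMem a y ↔ ∃ z, TSet z ∧ TMem z x ∧ TMem a z
  power : ∀ x : N, TSet x → ∃ y, TSet y ∧ ∀ a, TMem a y ↔
    ∃ z, TSet z ∧ (∀ w, TMem w z → TMem w x) ∧ a = z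
  regularity : ∀ x : N, TSet x → x ≠ tEmp N → ∃ a, TMem a x ∧ ∀ b, TMem b a → ¬ TMem b x
  infinity : TSet (tOmg N) ∧ TMem (tEmp N) (tOmg N) ∧
    (∀ a, TMem a (tOmg N) → TMem (tPlus a) (tOmg N)) ∧
    ∀ b, TMem b (tOmg N) → ((¬ ∃ c, TMem c (tOmg N) ∧ b = tPlus c) ↔ b = tEmp N)
  plus : ∀ a b : N, b = tPlus a ↔ ∃ x, TSet x ∧ b = x ∧ ∀ c, TMem c x ↔ c = a
  funNoElem : ∀ x : N, TSet x → ∀ f : N, TFun f x → ∀ a, ¬ TMem a f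
  funTotal : ∀ x : N, TSet x → ∀ f : N, TFun f x → x ≠ tEmp N → ∃ y, TSet y ∧ ∃ z, TSet z ∧
    TOnto f y z ∧ ∀ a, TMem a y → ∃ b, TMaps f a b ∧ ∀ b', TMaps f a b' → b' = b
  funDomain : ∀ x : N, TSet x → ∀ f : N, TFun f x → ∀ a, a ≠ x → ∀ b, ¬ TOnto f a b
  funOutside : ∀ x : N, TSet x → ∀ f : N, TFun f x → ∀ a, ¬ TMem a x → ∀ b, ¬ TMaps f a b
  funRange : ∀ x : N, TSet x → ∀ f : N, TFun f x → x ≠ tEmp N → ∀ b, TOnto f x b →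
    ∃ z, TSet z ∧ b = z ∧ ∀ c, TMem c z ↔ ∃ a, TMem a x ∧ TMaps f a c
  funPreimage : ∀ x : N, TSet x → x ≠ tEmp N → ∀ f : N, TFun f x → ∀ y, TSet y → TOnto f x y →
    ∀ b, ∃ z, TSet z ∧ ∀ a, TMem a z ↔ TMem a x ∧ TMaps f a b
  inactive : TFun (tOne N) (tEmp N) ∧ TOnto (tOne N) (tEmp N) (tEmp N) ∧
    ∀ a b, ¬ TMaps (tOne N) a b
  urFunction : ∀ a b : N, ∃ f, TFun f (tPlus a) ∧ TOnto f (tPlus a) (tPlus b) ∧ TMaps f a b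
  funRegularity : ∀ x : N, TSet x → ∀ f : N, TFun f x → ∀ y, TSet y → TOnto f x y →
    ∀ a, ¬ TMaps f f a ∧ ¬ TMaps f a f
  separation : ∀ (m : ℕ) (φ : LT.Formula (Fin m ⊕ Fin 1)) (p : Fin m → N) (x : N), TSet x →
    ∃ y, TSet y ∧ ∀ a, TMem a y ↔ TMem a x ∧ φ.Realize (Sum.elim p ![a])
  replacement : ∀ (m : ℕ) (ψ : LT.Formula (Fin m ⊕ Fin 2)) (p : Fin m → N) (x : N), TSet x →
    (∀ a, TMem a x → ∃ b, ψ.Realize (Sum.elim p ![a, b]) ∧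
      ∀ b', ψ.Realize (Sum.elim p ![a, b']) → b' = b) →
    ∃ z, TSet z ∧ ∀ c, TMem c z ↔ ∃ a, TMem a x ∧ ψ.Realize (Sum.elim p ![a, c])
  reverseGraph : ∀ f : N, TSet f → ∀ x, TSet x → ∀ y, TSet y → IsGraph f x y →
    ∃ h, TFun h x ∧ ∀ a b, TMaps h a b ↔ TupleMem TMem TSet a b f

theorem models_of_tModel (h : TModel N) : N ⊨ TInfty0 := by
  refine ⟨?_⟩
  rintro σ (((((hσ | hσ) | hσ) | ⟨m, φ, rfl⟩) | ⟨m, φ, rfl⟩) | rfl)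
  · rcases hσ with rfl | rfl | rfl
    · simp [SetsAndFunctions.sortThing, Sentence.Realize, Formula.Realize]
      simpa [Fin.snoc] using h.sortThing
    · simp [SetsAndFunctions.sortFun, Sentence.Realize, Formula.Realize]
      simpa [Fin.snoc] using h.sortFun
    · simp [SetsAndFunctions.sortNonempty, Sentence.Realize, Formula.Realize]
      simpa [Fin.snoc] using h.sortNonempty
  · rcases hσ with rfl | rfl | rfl | rfl | rfl | rfl | rfl | rfl | rfl | rfl
    · simp [axExt, Sentence.Realize, Formula.Realize]
      simpa [Fin.snoc] using h.ext
    · simp [axFunNotSet, Sentence.Realize, Formula.Realize]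
      simpa [Fin.snoc] using h.funNotSet
    · simp [axSetNotFun, Sentence.Realize, Formula.Realize]
      simpa [Fin.snoc] using h.setNotFun
    · simp [axEmpty, Sentence.Realize, Formula.Realize]
      simpa [Fin.snoc] using h.empty
    · simp [axPair, Sentence.Realize, Formula.Realize]
      simpa [Fin.snoc] using h.pair
    · simp [axUnion, Sentence.Realize, Formula.Realize]
      simpa [Fin.snoc] using h.union
    · simp [axPower, Sentence.Realize, Formula.Realize]
      simpa [Fin.snoc] using h.power
    · simp [axRegularity, Sentence.Realize, Formula.Realize]
      simpa [Fin.snoc] using h.regularity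
    · simp [axInfinity, Sentence.Realize, Formula.Realize]
      simpa [Fin.snoc, and_assoc] using h.infinity
    · simp [axPlus, Sentence.Realize, Formula.Realize]
      simpa [Fin.snoc] using h.plus
  · rcases hσ with rfl | rfl | rfl | rfl | rfl | rfl | rfl | rfl | rfl
    · simp [axFunNoElem, Sentence.Realize, Formula.Realize]
      simpa [Fin.snoc] using h.funNoElem
    · simp [axFunTotal, Sentence.Realize, Formula.Realize]
      simpa [Fin.snoc] using h.funTotal
    · simp [axFunDomain, Sentence.Realize, Formula.Realize]
      simpa [Fin.snoc] using h.funDomain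
    · simp [axFunOutside, Sentence.Realize, Formula.Realize]
      simpa [Fin.snoc] using h.funOutside
    · simp [axFunRange, Sentence.Realize, Formula.Realize]
      simpa [Fin.snoc] using h.funRange
    · simp [axFunPreimage, Sentence.Realize, Formula.Realize]
      simpa [Fin.snoc] using h.funPreimage
    · simp [axInactive, Sentence.Realize, Formula.Realize]
      simpa [Fin.snoc] using h.inactive
    · simp [axUrFunction, Sentence.Realize, Formula.Realize]
      simpa [Fin.snoc] using h.urFunction
    · simp [axFunRegularity, Sentence.Realize, Formula.Realize]
      simpa [Fin.snoc] using h.funRegularity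
  · refine (realize_closure _).2 fun p => ?_
    rw [Formula.Realize]
    simp [realize_at'_one]
    simpa [Fin.snoc] using h.separation m φ p
  · refine (realize_closure _).2 fun p => ?_
    rw [Formula.Realize]
    simp [realize_at'_two]
    simpa [Fin.snoc] using h.replacement m φ p
  · simp [SetsAndFunctions.reverseGraph, Sentence.Realize, Formula.Realize]
    simpa [Fin.snoc] using h.reverseGraph

end TModels

/-! ## Formulas of the theory of sets and functions define definable predicates -/

section Interpretation

variable {L : FirstOrder.Language.{0, 0}} {M N : Type} [L.Structure M] [LT.Structure N] {r : M → N}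

/-- Terms are treated through their graphs, with the inner value of `x⁺` quantified away. The maps
`i` and `s` provide the weakening needed when that quantifier adds a variable. -/
theorem dfn_term_graph (hr : Function.Surjective r) (he : Dfn₂ L r (N := N) (· = ·))
    (hp : Dfn₂ L r fun x y : N => y = tPlus x) {β : Type} (t : LT.Term β) :
    ∀ {γ : Type} (i : γ) (s : β → γ), Dfn L r fun w : γ → N => w i = t.realize fun b => w (s b) := by
  induction t with
  | var b => exact fun i s => he.app hr (.var _) (.var _)
  | @func l F ts ih =>
    intro γ i s
    cases F with
    | empty =>
      refine (he.app hr (.var i) (.const (tEmp N))).congr fun w => ?_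
      exact iff_of_eq (congrArg (w i = ·) (congrArg (Structure.funMap (L := LT) (n := 0)
        TFunc.empty) (Subsingleton.elim _ _)))
    | omega =>
      refine (he.app hr (.var i) (.const (tOmg N))).congr fun w => ?_
      exact iff_of_eq (congrArg (w i = ·) (congrArg (Structure.funMap (L := LT) (n := 0)
        TFunc.omega) (Subsingleton.elim _ _)))
    | inactive =>
      refine (he.app hr (.var i) (.const (tOne N))).congr fun w => ?_
      exact iff_of_eq (congrArg (w i = ·) (congrArg (Structure.funMap (L := LT) (n := 0)
        TFunc.inactive) (Subsingleton.elim _ _)))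
    | plus =>
      have : Dfn L r fun w : γ → N => ∃ x, x = (ts 0).realize (fun b => w (s b)) ∧ w i = tPlus x :=
        .ex hr (.and (ih 0 none fun b => some (s b)) (hp.app hr (.var _) (.var _)))
      refine this.congr fun w => ?_
      rw [exists_eq_left]
      refine iff_of_eq (congrArg (w i = ·) (congrArg (Structure.funMap (L := LT) (n := 1)
        TFunc.plus) (funext fun j => ?_)))
      fin_cases j
      rfl

/-- The interpretation of the language of sets and functions in `L`: once the atomic predicates and
the successor are definable, so is every formula. This reduces the schemata to those of the coded
universe. -/
theorem dfn_realize (hr : Function.Surjective r) (he : Dfn₂ L r (N := N) (· = ·))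
    (hp : Dfn₂ L r fun x y : N => y = tPlus x) (hS : Dfn₁ L r (TSet (N := N)))
    (hF : Dfn₂ L r (TFun (N := N))) (hE : Dfn₂ L r (TMem (N := N)))
    (hO : Dfn₃ L r (TOnto (N := N))) (hM : Dfn₃ L r (TMaps (N := N)))
    {α : Type} {n : ℕ} (φ : LT.BoundedFormula α n) :
    Dfn L r fun w : α ⊕ Fin n → N =>
      φ.Realize (fun i => w (Sum.inl i)) fun i => w (Sum.inr i) := by
  have hw : ∀ {n : ℕ} (w : α ⊕ Fin n → N),
      (Sum.elim (fun i => w (Sum.inl i)) fun i => w (Sum.inr i)) = w := fun w => by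
    funext x; rcases x with x | x <;> rfl
  have ht := fun {n : ℕ} (t : LT.Term (α ⊕ Fin n)) => @dfn_term_graph L M N _ _ r hr he hp _ t
  induction φ with
  | falsum => exact .false
  | equal s t =>
    have : Dfn L r fun w => ∃ x, x = s.realize w ∧ x = t.realize w :=
      .ex hr (.and (ht s _ _) (ht t _ _))
    refine this.congr fun w => ?_
    rw [exists_eq_left, BoundedFormula.Realize, hw]
  | rel R ts =>
    cases R with
    | isSet =>
      have : Dfn L r fun w => ∃ x, x = (ts 0).realize w ∧
          TSet x :=
        .ex hr (.and (ht _ _ _) (hS.app hr (.var _)))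
      refine this.congr fun w => ?_
      simp only [exists_eq_left]
      refine iff_of_eq (congrArg (Structure.RelMap (L := LT) (n := 1) TRel.isSet)
        (funext fun j => ?_))
      rw [hw]
      fin_cases j; rfl
    | isFun =>
      have : Dfn L r fun w => ∃ x, x = (ts 0).realize w ∧ ∃ y, y = (ts 1).realize w ∧
          TFun x y :=
        .ex hr (.and (ht _ _ _) (.ex hr (.and (ht _ _ _) (hF.app hr (.var _) (.var _)))))
      refine this.congr fun w => ?_
      simp only [exists_eq_left]
      refine iff_of_eq (congrArg (Structure.RelMap (L := LT) (n := 2) TRel.isFun)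
        (funext fun j => ?_))
      rw [hw]
      fin_cases j <;> rfl
    | mem =>
      have : Dfn L r fun w => ∃ x, x = (ts 0).realize w ∧ ∃ y, y = (ts 1).realize w ∧
          TMem x y :=
        .ex hr (.and (ht _ _ _) (.ex hr (.and (ht _ _ _) (hE.app hr (.var _) (.var _)))))
      refine this.congr fun w => ?_
      simp only [exists_eq_left]
      refine iff_of_eq (congrArg (Structure.RelMap (L := LT) (n := 2) TRel.mem)
        (funext fun j => ?_))
      rw [hw]
      fin_cases j <;> rfl
    | onto =>
      have : Dfn L r fun w => ∃ x, x = (ts 0).realize w ∧ ∃ y, y = (ts 1).realize w ∧ ∃ z, z = (ts 2).realize w ∧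
          TOnto x y z :=
        .ex hr (.and (ht _ _ _) (.ex hr (.and (ht _ _ _) (.ex hr (.and (ht _ _ _) (hO.app hr (.var _) (.var _) (.var _)))))))
      refine this.congr fun w => ?_
      simp only [exists_eq_left]
      refine iff_of_eq (congrArg (Structure.RelMap (L := LT) (n := 3) TRel.onto)
        (funext fun j => ?_))
      rw [hw]
      fin_cases j <;> rfl
    | maps =>
      have : Dfn L r fun w => ∃ x, x = (ts 0).realize w ∧ ∃ y, y = (ts 1).realize w ∧ ∃ z, z = (ts 2).realize w ∧
          TMaps x y z :=
        .ex hr (.and (ht _ _ _) (.ex hr (.and (ht _ _ _) (.ex hr (.and (ht _ _ _) (hM.app hr (.var _) (.var _) (.var _)))))))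
      refine this.congr fun w => ?_
      simp only [exists_eq_left]
      refine iff_of_eq (congrArg (Structure.RelMap (L := LT) (n := 3) TRel.maps)
        (funext fun j => ?_))
      rw [hw]
      fin_cases j <;> rfl
  | imp φ ψ h₁ h₂ => exact h₁.imp h₂
  | @all n φ ih =>
    refine .all hr ?_
    refine (ih.subst hr (β := Option (α ⊕ Fin n)) (τ := Sum.elim (fun a w => w (some (.inl a)))
      (Fin.lastCases (fun w => w none) fun j w => w (some (.inr j)))) ?_).congr fun w => ?_
    · rintro (a | i)
      · exact .var _
      · refine Fin.lastCases ?_ (fun j => ?_) i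
        · simpa using IsCoord.var _
        · simpa using IsCoord.var _
    · refine iff_of_eq (congrArg (φ.Realize _) (funext fun i => ?_))
      refine Fin.lastCases ?_ (fun j => ?_) i <;> simp

end Interpretation

/-! ## The model of the theory of sets and functions in a coded universe -/

section Model

variable {N : Type} (E : N → N → Prop) (S : N → Prop) (C : N → N → Prop)

/-- No two tuples in `F` have the same first component. -/
def Functional (F : N) : Prop := ∀ a b b', TupleMem E S a b F → TupleMem E S a b' F → b = b'

/-- `f` is the code of a functional set that contains the tuple of `a` and `b`. -/
def CodeMaps (f a b : N) : Prop := ∃ F, C f F ∧ Functional E S F ∧ TupleMem E S a b F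

/-- `f` is a non-set that maps exactly the elements of `x`. -/
def CodeFun (f x : N) : Prop := ¬ S f ∧ S x ∧ ∀ a, E a x ↔ ∃ b, CodeMaps E S C f a b

/-- `f` is a function on `x` with range `y`. -/
def CodeOnto (f x y : N) : Prop :=
  CodeFun E S C f x ∧ S y ∧ ∀ b, E b y ↔ ∃ a, CodeMaps E S C f a b

/-- The structure for the theory of sets and functions on a coded universe. -/
@[reducible] def codedStructure (e w i : N) (σ : N → N) : LT.Structure N where
  funMap {n} F xs := match n, F, xs with
    | _, .empty, _ => e
    | _, .omega, _ => w
    | _, .inactive, _ => i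
    | _, .plus, xs => σ (xs 0)
  RelMap {n} R xs := match n, R, xs with
    | _, .isSet, xs => S (xs 0)
    | _, .isFun, xs => CodeFun E S C (xs 0) (xs 1)
    | _, .mem, xs => E (xs 0) (xs 1)
    | _, .onto, xs => CodeOnto E S C (xs 0) (xs 1) (xs 2)
    | _, .maps, xs => CodeMaps E S C (xs 0) (xs 1) (xs 2)

variable {E S C} {L : FirstOrder.Language.{0, 0}} {M : Type} [L.Structure M] {r : M → N}

/-! ### Functions in a coded universe and verification of the axioms -/

namespace CodedUniverse

theorem mem_asymm (U : CodedUniverse L r E S C) (x y : N) (h₁ : E x y) : ¬ E y x := by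
  intro h₂
  obtain ⟨p, -, hp⟩ := U.pair x y
  obtain ⟨m, hm, hmin⟩ := U.regularity p ⟨x, (hp x).2 (.inl rfl)⟩
  rcases (hp m).1 hm with rfl | rfl
  · exact hmin y h₂ ((hp y).2 (.inr rfl))
  · exact hmin x h₁ ((hp x).2 (.inl rfl))

theorem exists_tuple (U : CodedUniverse L r E S C) (a b : N) : ∃ p, IsTuple E S p a b := by
  obtain ⟨q, hq⟩ := U.pair a b
  obtain ⟨p, hp⟩ := U.pair a q
  exact ⟨p, q, hq, hp⟩

theorem codeMaps_unique (U : CodedUniverse L r E S C) {f a b b' : N} (h : CodeMaps E S C f a b)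
    (h' : CodeMaps E S C f a b') : b = b' := by
  obtain ⟨F, hF, hf, hb⟩ := h
  obtain ⟨F', hF', -, hb'⟩ := h'
  obtain rfl := U.code_unique f F F' hF hF'
  exact hf a b b' hb hb'

theorem dfn_codeMaps (U : CodedUniverse L r E S C) : Dfn₃ L r (CodeMaps E S C) := by
  have ht := dfn_tupleMem U.surj U.dfn_mem U.dfn_isSet U.dfn_eq
  exact .ex U.surj (.and (U.dfn_code.app U.surj (.var _) (.var _)) (.and (.all U.surj (.all U.surj
    (.all U.surj (.imp (ht.app U.surj (.var _) (.var _) (.var _)) (.imp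
      (ht.app U.surj (.var _) (.var _) (.var _)) (U.dfn_eq.app U.surj (.var _) (.var _)))))))
    (ht.app U.surj (.var _) (.var _) (.var _))))

theorem dfn_codeFun (U : CodedUniverse L r E S C) : Dfn₂ L r (CodeFun E S C) :=
  .and (U.dfn_isSet.app U.surj (.var _)).not (.and (U.dfn_isSet.app U.surj (.var _))
    (.all U.surj (.iff (U.dfn_mem.app U.surj (.var _) (.var _))
      (.ex U.surj (U.dfn_codeMaps.app U.surj (.var _) (.var _) (.var _))))))

theorem dfn_codeOnto (U : CodedUniverse L r E S C) : Dfn₃ L r (CodeOnto E S C) :=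
  .and (U.dfn_codeFun.app U.surj (.var _) (.var _)) (.and (U.dfn_isSet.app U.surj (.var _))
    (.all U.surj (.iff (U.dfn_mem.app U.surj (.var _) (.var _))
      (.ex U.surj (U.dfn_codeMaps.app U.surj (.var _) (.var _) (.var _))))))

/-- If `f` codes `F`, the components of tuples in `F` belong to ⋃⋃F. If `f` codes nothing, it maps
nothing. Domain and range are then separated from this set. -/
theorem exists_field (U : CodedUniverse L r E S C) (f : N) :
    ∃ y, S y ∧ ∀ a b, CodeMaps E S C f a b → E a y ∧ E b y := by
  by_cases hf : ∃ F, C f F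
  · obtain ⟨F, hF⟩ := hf
    obtain ⟨u, hu, hu'⟩ := U.union F (U.isSet_of_code f F hF)
    obtain ⟨y, hy, hy'⟩ := U.union u hu
    refine ⟨y, hy, ?_⟩
    rintro a b ⟨F', hF', -, p, ⟨q, hq, hp⟩, hpF⟩
    obtain rfl := U.code_unique f F F' hF hF'
    have hqu := (hu' q).2 ⟨p, hpF, (hp.2 q).2 (.inr rfl)⟩
    exact ⟨(hy' a).2 ⟨q, hqu, (hq.2 a).2 (.inl rfl)⟩, (hy' b).2 ⟨q, hqu, (hq.2 b).2 (.inr rfl)⟩⟩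
  · obtain ⟨e, he, -⟩ := U.empty
    exact ⟨e, he, fun a b ⟨F, hF, _⟩ => absurd ⟨F, hF⟩ hf⟩

theorem exists_domain (U : CodedUniverse L r E S C) {f : N} (hf : ¬ S f) :
    ∃ x, CodeFun E S C f x := by
  obtain ⟨y, hy, hfy⟩ := U.exists_field f
  obtain ⟨x, hx, hx'⟩ := U.separation (fun a => ∃ b, CodeMaps E S C f a b)
    (.ex U.surj (U.dfn_codeMaps.app U.surj (.const _) (.var _) (.var _))) y hy
  exact ⟨x, hf, hx, fun a => (hx' a).trans
    ⟨fun h => h.2, fun h => ⟨(hfy a h.choose h.choose_spec).1, h⟩⟩⟩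

theorem exists_range (U : CodedUniverse L r E S C) {f x : N} (hf : CodeFun E S C f x) :
    ∃ z, CodeOnto E S C f x z := by
  obtain ⟨y, hy, hfy⟩ := U.exists_field f
  obtain ⟨z, hz, hz'⟩ := U.separation (fun b => ∃ a, CodeMaps E S C f a b)
    (.ex U.surj (U.dfn_codeMaps.app U.surj (.const _) (.var _) (.var _))) y hy
  exact ⟨z, hf, hz, fun b => (hz' b).trans
    ⟨fun h => h.2, fun h => ⟨(hfy h.choose b h.choose_spec).2, h⟩⟩⟩

theorem codeFun_unique (U : CodedUniverse L r E S C) {f x y : N} (hx : CodeFun E S C f x)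
    (hy : CodeFun E S C f y) : x = y :=
  U.ext x y hx.2.1 hy.2.1 fun a => (hx.2.2 a).trans (hy.2.2 a).symm

theorem exists_codeMaps_iff (U : CodedUniverse L r E S C) {F : N} (hS : S F)
    (hF : Functional E S F) :
    ∃ f, ¬ S f ∧ ∀ a b, CodeMaps E S C f a b ↔ TupleMem E S a b F := by
  obtain ⟨f, hf⟩ := U.exists_code F hS
  refine ⟨f, U.not_isSet_of_code f F hf, fun a b => ⟨?_, fun h => ⟨F, hf, hF, h⟩⟩⟩
  rintro ⟨F', hF', -, h⟩
  rwa [U.code_unique f F F' hf hF']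

/-- The diagonal of `x` is a set by replacement, and its code is the identity on `x`. This makes the
range of each composite variable nonempty and supplies 1_∅. -/
theorem exists_identity (U : CodedUniverse L r E S C) {x : N} (hx : S x) :
    ∃ f, CodeFun E S C f x := by
  obtain ⟨F, hS, hF⟩ := U.replacement (fun a p => IsTuple E S p a a)
    ((dfn_isTuple U.surj U.dfn_mem U.dfn_isSet U.dfn_eq).app U.surj (.var _) (.var _) (.var _))
    x hx fun a _ => by
      obtain ⟨p, hp⟩ := U.exists_tuple a a
      exact ⟨p, hp, fun p' hp' => hp'.unique U.ext hp⟩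
  have hT : ∀ a b, TupleMem E S a b F → E a x ∧ a = b := by
    rintro a b ⟨p, hp, hpF⟩
    obtain ⟨c, hc, hpc⟩ := (hF p).1 hpF
    obtain ⟨rfl, rfl⟩ := hp.inj U.mem_asymm hpc
    exact ⟨hc, rfl⟩
  obtain ⟨f, hf, hm⟩ := U.exists_codeMaps_iff hS fun a b b' h h' =>
    (hT a b h).2.symm.trans (hT a b' h').2
  refine ⟨f, hf, hx, fun a => ⟨fun ha => ?_, fun ⟨b, hb⟩ => (hT a b ((hm a b).1 hb)).1⟩⟩
  obtain ⟨p, hp⟩ := U.exists_tuple a a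
  exact ⟨a, (hm a a).2 ⟨p, hp, (hF p).2 ⟨a, ha, hp⟩⟩⟩

theorem exists_mapsto (U : CodedUniverse L r E S C) (a b : N) :
    ∃ f, ¬ S f ∧ ∀ a' b', CodeMaps E S C f a' b' ↔ a' = a ∧ b' = b := by
  obtain ⟨p, hp⟩ := U.exists_tuple a b
  obtain ⟨F, hS, hF⟩ := U.pair p p
  have hT : ∀ a' b', TupleMem E S a' b' F ↔ a' = a ∧ b' = b := by
    refine fun a' b' => ⟨?_, ?_⟩
    · rintro ⟨p', hp', hpF⟩
      obtain rfl : p' = p := by simpa [hF] using hpF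
      exact hp'.inj U.mem_asymm hp
    · rintro ⟨rfl, rfl⟩
      exact ⟨p, hp, (hF p).2 (.inl rfl)⟩
  obtain ⟨f, hf, hm⟩ := U.exists_codeMaps_iff hS fun c d d' h h' =>
    ((hT c d).1 h).2.trans ((hT c d').1 h').2.symm
  exact ⟨f, hf, fun a' b' => (hm a' b').trans (hT a' b')⟩

theorem not_codeMaps_self (U : CodedUniverse L r E S C) (f a : N) :
    ¬ CodeMaps E S C f f a ∧ ¬ CodeMaps E S C f a f := by
  constructor
  · rintro ⟨F, hF, -, p, ⟨q, hq, hp⟩, hpF⟩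
    exact U.code_not_mem₂ f F p hF hpF ((hp.2 f).2 (.inl rfl))
  · rintro ⟨F, hF, -, p, ⟨q, hq, hp⟩, hpF⟩
    exact U.code_not_mem₃ f F p q hF hpF ((hp.2 q).2 (.inr rfl)) ((hq.2 f).2 (.inr rfl))

theorem exists_tModel (U : CodedUniverse L r E S C) : ∃ _ : LT.Structure N, TModel N := by
  obtain ⟨e, he, he'⟩ := U.empty
  obtain ⟨W, hW, hW₀, hW₁, hW₂⟩ := U.infinity
  obtain ⟨i, hi⟩ := U.exists_identity he
  have hsing : ∀ x, ∃ y, IsSing E S y x := fun x => by simpa [IsSing] using U.pair x x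
  choose σ hσ using hsing
  -- Singletons are unique, so the chosen `σ` has a definable graph.
  have hsu : ∀ x y, IsSing E S y x ↔ y = σ x := fun x y =>
    ⟨fun hy => U.ext _ _ hy.1 (hσ x).1 fun z => (hy.2 z).trans ((hσ x).2 z).symm,
      fun hy => hy ▸ hσ x⟩
  have heu : ∀ x, S x → (∀ y, ¬ E y x) → x = e := fun x hx hx' =>
    U.ext _ _ hx he fun z => iff_of_false (hx' z) (he' z)
  -- ω is interpreted by the set `W` of iterated singletons, and 1_∅ by the function `i` on the
  -- empty set.
  let _ := codedStructure E S C e W i σ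
  have hd : Dfn₂ L r fun x y => y = σ x := by
    refine Dfn.congr (P := fun w : Fin 2 → N => IsSing E S (w 1) (w 0)) (.and
      (U.dfn_isSet.app U.surj (.var _)) (.all U.surj (.iff (U.dfn_mem.app U.surj (.var _) (.var _))
        (U.dfn_eq.app U.surj (.var _) (.var _))))) fun w => hsu _ _
  have hdfn := fun {n : ℕ} {α : Type} (φ : LT.BoundedFormula α n) => dfn_realize (r := r) U.surj
    U.dfn_eq hd U.dfn_isSet U.dfn_codeFun U.dfn_mem U.dfn_codeOnto U.dfn_codeMaps φ
  have hSet : TSet (N := N) = S := rfl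
  have hMem : TMem (N := N) = E := rfl
  have hFun : TFun (N := N) = CodeFun E S C := rfl
  have hOnto : TOnto (N := N) = CodeOnto E S C := rfl
  have hMaps : TMaps (N := N) = CodeMaps E S C := rfl
  have hEmp : tEmp N = e := rfl
  have hOmg : tOmg N = W := rfl
  have hOne : tOne N = i := rfl
  have hPlus : tPlus (N := N) = σ := rfl
  refine ⟨inferInstance, ?_⟩
  constructor
  all_goals simp only [IsGraph, hSet, hMem, hFun, hOnto, hMaps, hEmp, hOmg, hOne, hPlus]
  case sortThing =>
    intro x
    by_cases hx : S x
    · exact .inl hx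
    · obtain ⟨y, hy⟩ := U.exists_domain hx
      exact .inr ⟨y, hy.2.1, hy⟩
  case sortFun => exact fun f x hf => hf.2.1
  case sortNonempty => exact fun x hx => U.exists_identity hx
  case ext => exact fun x hx y hy => ⟨fun h z => h ▸ Iff.rfl, U.ext x y hx hy⟩
  case funNotSet => exact fun x _ f hf y hy h => hf.1 (h ▸ hy)
  case setNotFun =>
    exact fun x hx a b => ⟨fun h => h.1.1 hx, fun ⟨F, hF, _⟩ => U.not_isSet_of_code x F hF hx⟩
  case empty => exact ⟨he, he'⟩
  case pair => exact U.pair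
  case union =>
    intro x hx
    obtain ⟨y, hy, hE⟩ := U.union x hx
    exact ⟨y, hy, fun a => (hE a).trans ⟨fun ⟨z, hz, ha⟩ => ⟨z, U.isSet_of_mem a z ha, hz, ha⟩,
      fun ⟨z, _, hz⟩ => ⟨z, hz⟩⟩⟩
  case power =>
    intro x hx
    obtain ⟨y, hy, hE⟩ := U.power x hx
    refine ⟨y, hy, fun a => (hE a).trans ⟨fun h => ⟨a, h.1, h.2, rfl⟩, ?_⟩⟩
    rintro ⟨z, hz, hzx, rfl⟩
    exact ⟨hz, hzx⟩
  case regularity =>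
    intro x hx hne
    refine U.regularity x ?_
    by_contra hn
    exact hne (heu x hx (not_exists.1 hn))
  case infinity =>
    refine ⟨hW, hW₀ e he he', fun a ha => hW₁ a _ ha (hσ a), fun b hb => ⟨fun hn => ?_, ?_⟩⟩
    · rcases hW₂ b hb with h | ⟨y, hy, hby⟩
      · exact heu b h.1 h.2
      · exact absurd ⟨y, hy, (hsu y b).1 hby⟩ hn
    · rintro rfl ⟨c, -, hc⟩
      exact he' c (hc ▸ ((hσ c).2 c).2 rfl)
  case plus =>
    refine fun a b => (hsu a b).symm.trans ⟨fun h => ⟨b, h.1, rfl, h.2⟩, ?_⟩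
    rintro ⟨x, hx, rfl, h⟩
    exact ⟨hx, h⟩
  case funNoElem => exact fun x _ f hf a ha => hf.1 (U.isSet_of_mem a f ha)
  case funTotal =>
    intro x hx f hf _
    obtain ⟨z, hz⟩ := U.exists_range hf
    refine ⟨x, hx, z, hz.2.1, hz, fun a ha => ?_⟩
    obtain ⟨b, hb⟩ := (hf.2.2 a).1 ha
    exact ⟨b, hb, fun b' hb' => U.codeMaps_unique hb' hb⟩
  case funDomain => exact fun x _ f hf a ha b hb => ha (U.codeFun_unique hb.1 hf)
  case funOutside => exact fun x _ f hf a ha b hb => ha ((hf.2.2 a).2 ⟨b, hb⟩)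
  case funRange =>
    refine fun x _ f hf _ b hb => ⟨b, hb.2.1, rfl, fun c => (hb.2.2 c).trans
      ⟨fun ⟨a, ha⟩ => ⟨a, (hf.2.2 a).2 ⟨c, ha⟩, ha⟩, fun ⟨a, _, ha⟩ => ⟨a, ha⟩⟩⟩
  case funPreimage =>
    exact fun x hx _ f _ _ _ _ b => U.separation (fun a => CodeMaps E S C f a b)
      (U.dfn_codeMaps.app U.surj (.const _) (.var _) (.const _)) x hx
  case inactive =>
    have hn : ∀ a b, ¬ CodeMaps E S C i a b := fun a b hab => he' a ((hi.2.2 a).2 ⟨b, hab⟩)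
    exact ⟨hi, ⟨hi, he, fun b => iff_of_false (he' b) fun ⟨a, ha⟩ => hn a b ha⟩, hn⟩
  case urFunction =>
    intro a b
    obtain ⟨f, hf, hm⟩ := U.exists_mapsto a b
    have hF : CodeFun E S C f (σ a) := ⟨hf, (hσ a).1, fun c => by simp [(hσ a).2, hm]⟩
    exact ⟨f, hF, ⟨hF, (hσ b).1, fun c => by simp [(hσ b).2, hm]⟩, (hm a b).2 ⟨rfl, rfl⟩⟩
  case funRegularity => exact fun _ _ f _ _ _ _ a => U.not_codeMaps_self f a
  case separation =>
    intro m φ p x hx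
    refine U.separation (fun a => φ.Realize (Sum.elim p ![a])) ?_ x hx
    -- The parameters `p` are inserted as constants of the universe, that is, as parameters from
    -- `M`.
    refine ((hdfn φ).subst U.surj (β := Fin 1) (τ := Sum.elim (Sum.elim (fun j _ => p j)
      fun i w => w i) Fin.elim0) ?_).congr fun w => ?_
    · rintro ((j | j) | j)
      · exact .const _
      · exact .var _
      · exact j.elim0
    · refine iff_of_eq (congrArg₂ (BoundedFormula.Realize φ) (funext fun x => ?_) (Subsingleton.elim _ _))
      rcases x with x | x
      · rfl
      · fin_cases x; rfl
  case replacement =>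
    intro m φ p x hx
    refine U.replacement (fun a b => φ.Realize (Sum.elim p ![a, b])) ?_ x hx
    refine ((hdfn φ).subst U.surj (β := Fin 2) (τ := Sum.elim (Sum.elim (fun j _ => p j)
      fun i w => w i) Fin.elim0) ?_).congr fun w => ?_
    · rintro ((j | j) | j)
      · exact .const _
      · exact .var _
      · exact j.elim0
    · refine iff_of_eq (congrArg₂ (BoundedFormula.Realize φ) (funext fun x => ?_) (Subsingleton.elim _ _))
      rcases x with x | x
      · rfl
      · fin_cases x <;> rfl
  case reverseGraph =>
    rintro F hF x hx y hy ⟨hg₁, hg₂⟩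
    -- Injectivity of tuples turns the decomposition given by `hg₁` into a statement about the
    -- components at hand; then `hg₂` makes `F` functional with domain `x`.
    have hdom : ∀ a b, TupleMem E S a b F → E a x := by
      rintro a b ⟨p, hp, hpF⟩
      obtain ⟨a', ha', b', -, hp'⟩ := hg₁ p hpF
      rwa [(hp.inj U.mem_asymm hp').1]
    obtain ⟨f, hf, hm⟩ := U.exists_codeMaps_iff hF fun a b b' h h' => by
      obtain ⟨c, -, hc⟩ := hg₂ a (hdom a b h)
      exact (hc b h).trans (hc b' h').symm
    refine ⟨f, ⟨hf, hx, fun a => ⟨fun ha => ?_, fun ⟨b, hb⟩ => hdom a b ((hm a b).1 hb)⟩⟩, hm⟩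
    obtain ⟨b, hb, -⟩ := hg₂ a ha
    exact ⟨b, (hm a b).2 hb⟩

end CodedUniverse

end Model

/-! ## Relative consistency -/

instance : LZF.IsRelational := fun _ => inferInstanceAs (IsEmpty Empty)

instance : Countable LZF.Symbols := by
  have h₁ : Subsingleton (Σ l, LZF.Relations l) := ⟨by rintro ⟨_, ⟨⟩⟩ ⟨_, ⟨⟩⟩; rfl⟩
  have h₂ : IsEmpty (Σ l, LZF.Functions l) := ⟨fun x => isEmptyElim x.2⟩
  exact inferInstanceAs (Countable ((Σ l, LZF.Functions l) ⊕ (Σ l, LZF.Relations l)))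

theorem ZFModel.exists_models_tInfty0 {M : Type} [LZF.Structure M] (h : ZFModel M) :
    ∃ (N : Type) (_ : LT.Structure N), Nonempty N ∧ N ⊨ TInfty0 := by
  obtain ⟨o, ho⟩ := h.empty
  -- The thing {o} shows that there are things at all and serves as the image of `o` under the
  -- retraction.
  obtain ⟨d, hd⟩ := h.pair o o
  have hdo : d ≠ o := fun hdo => ho o (hdo ▸ (hd o).2 (.inl rfl))
  obtain ⟨inst, hT⟩ := (Thing.codedUniverse h ho ⟨d, hdo⟩).exists_tModel
  exact ⟨Thing o, inst, ⟨⟨d, hdo⟩⟩, models_of_tModel hT⟩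

end SetsAndFunctions

theorem mainTheorem2 :
    SetsAndFunctions.Consistent SetsAndFunctions.ZF →
      SetsAndFunctions.Consistent SetsAndFunctions.TInfty0 := by
  intro h
  obtain ⟨M, _, _, hM⟩ := SetsAndFunctions.exists_model_of_consistent h
  obtain ⟨N, _, _, hN⟩ := (SetsAndFunctions.zfModel_of_models hM).exists_models_tInfty0
  exact SetsAndFunctions.consistent_of_model hN
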